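/- All logarithms are to base 2, all alphabets are finite, and $\mathbf{SD}$ is statistical distance. **The protocol.** Let $(X^n,Y^n,Z^n)$ have joint distribution $P_{X^nY^nZ^n}$, where Alice sees $x^n\in\mathcal X^n$, Bob sees $y^n\in\mathcal Y^n$, and the adversary sees $z^n\in\mathcal Z^n$. A family $\{h_s: s\in\mathcal S\}$ of functions from $A$ to $B$ is *2-universal* if $\Pr[h_S(x)=h_S(x')]\le 1/|B|$ for all $x\ne x'$, with $S$ uniform on $\mathcal S$. Given $\lambda\in\mathbb R$, integers $t,\ell\ge 0$, and 2-universal families $h_s:\mathcal X^n\to\{0,1\}^t$ ($s\in\mathcal S$) and $\hat h_{s'}:\mathcal X^n\to\{0,1\}^\ell$ ($s'\in\mathcal S'$), the one-message protocol $\Pi_{\mathrm{SKA}}$ is the following. Alice draws independent uniform seeds $s,s'$, sends the single public message $F=(h_s(x^n),s,s')$, and computes the key $K_A=\hat h_{s'}(x^n)$. Bob forms the list $\mathcal T=\{\hat x^n: -\log P_{X^n|Y^n}(\hat x^n|y^n)\le\lambda\}$. If exactly one $\hat x^n\in\mathcal T$ satisfies $h_s(\hat x^n)=h_s(x^n)$,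 he computes $K_B=\hat h_{s'}(\hat x^n)$; otherwise he aborts. **Secret key.** A random variable $K$ on $\mathcal K$ is an $(\epsilon,\sigma)$-secret key established by a protocol with public communication $F$ and outputs $K_A,K_B$ if $\Pr[K_A=K_B=K]\ge 1-\epsilon$ and $\mathbf{SD}\big((K,F,Z);(U,F,Z)\big)\le\sigma$, where $Z$ is the adversary's side information and $U$ is uniform on $\mathcal K$ and independent of $(F,Z)$. **Theorem.** Let $0<\epsilon,\sigma<1$ and let $\mathcal X$ be a finite alphabet. There is a constant $C$, depending only on $\epsilon,\sigma,|\mathcal X|$, such that for every $n\ge 1$, all finite $\mathcal Y,\mathcal Z$, and every source with independent, not necessarily identically distributed, components $P_{X^nY^nZ^n}=\prod_{j=1}^n P_{X_jY_jZ_j}$ on $(\mathcal X\times\mathcal Y\times\mathcal Z)^n$, there are a real number $$L = H(X^n|Z^n)-H(X^n|Y^n)-\sqrt n\,f_{\epsilon,\sigma}(|\mathcal X|)-\log\frac{4n^3}{\epsilon\sigma^2}+r,\qquad |r|\le\frac{C}{\sqrt n},$$ $$f_{\epsilon,\sigma}(|\mathcal X|)=\sqrt2\,\log(|\mathcal X|+3)\left(\sqrt{\log(1/\epsilon)}+\sqrt{\log(2/\sigma)}\right),$$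 and parameters $\lambda\in\mathbb R$, $t\in\mathbb Z_{\ge 0}$, such that for every integer $\ell$ with $0\le\ell\le L$ (so for $\ell=\lfloor L\rfloor$ when $L\ge 0$) and for all 2-universal families $h$ into $\{0,1\}^t$ and $\hat h$ into $\{0,1\}^\ell$, $\Pi_{\mathrm{SKA}}$ with these parameters establishes Alice's output $K_A$ as an $(\epsilon,\sigma)$-secret key of length $\ell$ bits. -/

import Mathlib

/- Finite probability. A probability mass function (pmf) on a finite set `α` is an element of
`stdSimplex ℝ α`, i.e. a nonnegative real function on `α` with sum `1`. Logarithms have base 2. -/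

/-- The probability of the event `E` under the pmf `p`. -/
noncomputable def pmfProb {Ω : Type*} [Fintype Ω] (p : Ω → ℝ) (E : Ω → Prop) : ℝ :=
  open Classical in ∑ ω, if E ω then p ω else 0

/-- The pmf of the random variable `f`, defined on a finite probability space with pmf `p`. -/
noncomputable def pmfLaw {Ω α : Type*} [Fintype Ω] (p : Ω → ℝ) (f : Ω → α) : α → ℝ :=
  fun a => pmfProb p (fun ω => f ω = a)

/-- Statistical distance of two pmfs on the same alphabet. -/
noncomputable def statDist {α : Type*} [Fintype α] (p q : α → ℝ) : ℝ :=
  (1 / 2) * ∑ a, |p a - q a|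

/-- The uniform pmf. -/
noncomputable def uniformPMF (α : Type*) [Fintype α] : α → ℝ := fun _ => 1 / (Fintype.card α : ℝ)

theorem uniformPMF_mem (α : Type*) [Fintype α] [Nonempty α] :
    uniformPMF α ∈ stdSimplex ℝ α := by
  refine ⟨fun a => by unfold uniformPMF; positivity, ?_⟩
  have h : (Fintype.card α : ℝ) ≠ 0 := by exact_mod_cast Fintype.card_ne_zero
  simp [uniformPMF, h]

/-- The conditional probability `P_{A|B}(a|b)`, for a joint pmf `p = P_{AB}`. -/
noncomputable def condPMF {α β : Type*} [Fintype α] (p : α × β → ℝ) (a : α) (b : β) : ℝ :=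
  p (a, b) / ∑ a', p (a', b)

/-- The conditional Shannon entropy `H(A|B) = - 𝔼 log P_{A|B}(A|B)`, for a joint pmf `p = P_{AB}`.
Pairs of probability zero contribute zero. -/
noncomputable def condEntropy {α β : Type*} [Fintype α] [Fintype β] (p : α × β → ℝ) : ℝ :=
  -∑ a, ∑ b, p (a, b) * Real.logb 2 (condPMF p a b)

/-- The marginal `P_{AB}` of `P_{ABC}`. -/
noncomputable def margFst {α β γ : Type*} [Fintype γ] (p : α × β × γ → ℝ) : α × β → ℝ :=
  fun w => ∑ c, p (w.1, w.2, c)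

/-- The marginal `P_{AC}` of `P_{ABC}`. -/
noncomputable def margSnd {α β γ : Type*} [Fintype β] (p : α × β × γ → ℝ) : α × γ → ℝ :=
  fun w => ∑ b, p (w.1, b, w.2)

/-- The joint pmf `P_{XⁿYⁿZⁿ} = ∏ j, P_{X_j Y_j Z_j}` of independent, not necessarily identically
distributed, triples. -/
noncomputable def productSource {𝒳 𝒴 𝒵 : Type*} {n : ℕ} (P : Fin n → 𝒳 × 𝒴 × 𝒵 → ℝ) :
    (Fin n → 𝒳) × (Fin n → 𝒴) × (Fin n → 𝒵) → ℝ :=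
  fun w => ∏ j, P j (w.1 j, w.2.1 j, w.2.2 j)

/-- Bit strings of length `m`. -/
abbrev Bits (m : ℕ) : Type := Fin m → Bool

/-- The family `h` of functions `α → β`, indexed by a seed in `S`, is a 2-universal hash family:
for a uniformly random seed, two distinct points collide with probability at most `1 / |β|`. -/
def IsTwoUniversal {S α β : Type*} [Fintype S] [Fintype β] (h : S → α → β) : Prop :=
  ∀ x x' : α, x ≠ x' →
    pmfProb (uniformPMF S) (fun s => h s x = h s x') ≤ 1 / (Fintype.card β : ℝ)

/-- A one-message key agreement protocol with key alphabet `K`. Alice has an input in `A` and local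
randomness in `UA`, Bob has an input in `B` and local randomness in `UB`; Alice sends a single
public message in `M`, and each party then computes a key or aborts (`none`). -/
structure OneMessageProtocol (A B UA UB M K : Type*) [Fintype UA] [Fintype UB] where
  /-- The distribution of Alice's local randomness. -/
  randA : UA → ℝ
  randA_mem : randA ∈ stdSimplex ℝ UA
  /-- The distribution of Bob's local randomness. -/
  randB : UB → ℝ
  randB_mem : randB ∈ stdSimplex ℝ UB
  /-- The public message. -/
  message : A → UA → M
  /-- Alice's key. -/
  keyA : A → UA → M → Option K
  /-- Bob's key. -/
  keyB : B → UB → M → Option K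

namespace OneMessageProtocol

variable {A B C UA UB M K : Type*} [Fintype A] [Fintype B] [Fintype C] [Fintype UA] [Fintype UB]
  [Fintype M] [Fintype K]

/-- The pmf of `((X, Y, Z), U_A, U_B)` when `(X, Y, Z)` has the pmf `p`, and the local randomness of
the two parties is independent of everything else. -/
noncomputable def jointPMF (pr : OneMessageProtocol A B UA UB M K) (p : A × B × C → ℝ) :
    (A × B × C) × UA × UB → ℝ :=
  fun ω => p ω.1 * pr.randA ω.2.1 * pr.randB ω.2.2

/-- The public communication `F`, as a random variable. -/
def publicF (pr : OneMessageProtocol A B UA UB M K) (ω : (A × B × C) × UA × UB) : M :=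
  pr.message ω.1.1 ω.2.1

/-- The random variable `key` (on the space of the sources and the local randomness) is an
`(ε, σ)`-secret key established by the protocol `pr`, where Alice, Bob and Eve have the sources `X`,
`Y`, `Z` with joint pmf `p`:
reliability `Pr[K_A = K_B = K] ≥ 1 - ε`, and security `SD((K, F, Z); (U, F, Z)) ≤ σ` with `U`
uniform and independent of `(F, Z)`. -/
def IsSecretKey (pr : OneMessageProtocol A B UA UB M K) (p : A × B × C → ℝ)
    (key : (A × B × C) × UA × UB → K) (ε σ : ℝ) : Prop :=
  1 - ε ≤ pmfProb (pr.jointPMF p) (fun ω =>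
      pr.keyA ω.1.1 ω.2.1 (pr.publicF ω) = some (key ω) ∧
      pr.keyB ω.1.2.1 ω.2.2 (pr.publicF ω) = some (key ω)) ∧
  statDist
      (pmfLaw (pr.jointPMF p) (fun ω => (key ω, pr.publicF ω, ω.1.2.2)))
      (fun w : K × M × C =>
        uniformPMF K w.1 * pmfLaw (pr.jointPMF p) (fun ω => (pr.publicF ω, ω.1.2.2)) w.2) ≤ σ

end OneMessageProtocol

/-- Bob's list of guesses `{x̂ : -log P_{X|Y}(x̂|y) ≤ lam}`, where `-log 0 = ∞`, for a joint pmf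
`p = P_{XY}`. -/
def guessList {A B : Type*} [Fintype A] (p : A × B → ℝ) (lam : ℝ) (y : B) : Set A :=
  {x | 0 < condPMF p x y ∧ -Real.logb 2 (condPMF p x y) ≤ lam}

/-- Bob's reconciliation: the unique element of his list whose hash value under `g` is `v`, if there
is exactly one, and abort otherwise. -/
noncomputable def reconcile {A B V : Type*} [Fintype A] (p : A × B → ℝ) (lam : ℝ) (g : A → V)
    (y : B) (v : V) : Option A :=
  open Classical in
  if hx : ∃! x, x ∈ guessList p lam y ∧ g x = v then some hx.choose else none

/-- The hash-based one-message protocol, for a source with joint pmf `p = P_{XY}`, the list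
threshold `lam`, and hash families `h` (for reconciliation) and `h'` (for key extraction).
Alice draws independent uniform seeds `(s, s')`, publishes `(h_s(x), s, s')`, and computes the key
`h'_{s'}(x)`; Bob computes `h'_{s'}(x̂)` from his reconciled value `x̂`, or aborts. -/
noncomputable def skaProtocol {A B S S' V K : Type*} [Fintype A] [Fintype S] [Nonempty S]
    [Fintype S'] [Nonempty S'] (p : A × B → ℝ) (lam : ℝ) (h : S → A → V) (h' : S' → A → K) :
    OneMessageProtocol A B (S × S') Unit (V × S × S') K where
  randA := uniformPMF (S × S')
  randA_mem := uniformPMF_mem (S × S')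
  randB := uniformPMF Unit
  randB_mem := uniformPMF_mem Unit
  message x u := (h u.1 x, u.1, u.2)
  keyA x u _ := some (h' u.2 x)
  keyB y _ f := (reconcile p lam (h f.2.1) y f.1).map (h' f.2.2)

/-- The second-order coefficient
`f_{ε,σ}(k) = √2 log(k + 3) (√(log (1/ε)) + √(log (2/σ)))`. -/
noncomputable def secondOrderCoeff (ε σ : ℝ) (k : ℕ) : ℝ :=
  √2 * Real.logb 2 (k + 3) * (√(Real.logb 2 (1 / ε)) + √(Real.logb 2 (2 / σ)))

/-! For any source, two one-shot facts govern the protocol. Bob can fail only if `x` is not in his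
list or another element of the list has the same hash. Listed elements have conditional probability
at least `2^(-lam)`, so there are at most `2^lam` of them and the collision probability is at most
`2^lam / 2^t` (`skaProtocol_reliability`). The key is close to uniform by a smoothed leftover hash
lemma: the part of the source with `P(x|z) > 2^(-κ)` is discarded at the cost of its mass, and the
public hash counts as side information with `2^t` values, leaving `½ √(2^(t + ℓ - κ))`
(`skaProtocol_security`).

For an independent source the surprisal is a sum of independent terms, so Chernoff bounds place
`lam` above `H(X^n|Y^n)` and `κ` below `H(X^n|Z^n)` by order `√n`. Each term has second moment at
most `log(|𝒳|+3)^2`, by Jensen (`mean_surprisal_sq_le`), independently of `𝒴` and `𝒵`. This gives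
the tail `exp(-c²/2)` for a deviation of `√n c log(|𝒳|+3)`; the tail used for reliability also
carries a factor `exp(O(1/√n))`.

The moments are computed in nats, but `c²/2` is a base-2 logarithm of `1/ε`. Hence the list error
tends to `exp(-log₂(1/ε))`, strictly below `ε`, and a constant `γ` remains for collisions. For large
`n` the terms `log(1/γ)` and the rounding of `t` fit into the logarithmic term of `L`, so `r = 0`
works. For the finitely many other `n`, a large `C` makes `L` negative and no key length has to be
treated. -/

/-! ### One-shot bounds: leftover hashing and list reconciliation. -/

section OneShot

open Classical in
theorem IsTwoUniversal.sum_collision_le {S α β : Type*} [Fintype S] [Nonempty S] [Fintype β]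
    {h : S → α → β} (hh : IsTwoUniversal h) {x x' : α} (hx : x ≠ x') :
    ∑ s, (if h s x = h s x' then (1 : ℝ) else 0) ≤ Fintype.card S / Fintype.card β := by
  have h1 := hh x x' hx
  have hS : (0 : ℝ) < Fintype.card S := by exact_mod_cast Fintype.card_pos
  have h2 : pmfProb (uniformPMF S) (fun s => h s x = h s x')
      = (∑ s, (if h s x = h s x' then (1 : ℝ) else 0)) / Fintype.card S := by
    unfold pmfProb uniformPMF
    rw [Finset.sum_div]
    refine Finset.sum_congr rfl fun s _ => ?_
    split_ifs <;> simp
  rw [h2, div_le_iff₀ hS] at h1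
  calc _ ≤ _ := h1
    _ = _ := by ring

-- Expanding the square gives the collision sum minus `R²/|β|`. Two-universality bounds the
-- off-diagonal collisions by the average that is subtracted, so only the diagonal `∑ r²` survives.
open Classical in
theorem IsTwoUniversal.sum_sq_deviation_le {S α β : Type*} [Fintype S] [Nonempty S] [Fintype α]
    [Fintype β] [Nonempty β] {h : S → α → β} (hh : IsTwoUniversal h) (r : α → ℝ)
    (hr : ∀ x, 0 ≤ r x) :
    ∑ s, ∑ k, ((∑ x, if h s x = k then r x else 0) - (∑ x, r x) / Fintype.card β) ^ 2
      ≤ Fintype.card S * ∑ x, r x ^ 2 := by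
  have hβ : (0 : ℝ) < Fintype.card β := by exact_mod_cast Fintype.card_pos
  set R := ∑ x, r x with hR
  set m : ℝ := (Fintype.card β : ℝ) with hm
  set N : ℝ := (Fintype.card S : ℝ) with hN
  have h1 : ∀ s, ∑ k, ((∑ x, if h s x = k then r x else 0) - R / m) ^ 2
      = (∑ x, ∑ x', r x * r x' * (if h s x = h s x' then 1 else 0)) - R ^ 2 / m := by
    intro s
    have e1 : ∑ k, (∑ x, if h s x = k then r x else 0) = R := by
      rw [Finset.sum_comm]; simp [hR]
    have e2 : ∑ k, (∑ x, if h s x = k then r x else 0) ^ 2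
        = ∑ x, ∑ x', r x * r x' * (if h s x = h s x' then 1 else 0) := by
      simp_rw [sq, Finset.sum_mul_sum]
      rw [Finset.sum_comm]
      refine Finset.sum_congr rfl fun x _ => ?_
      rw [Finset.sum_comm]
      refine Finset.sum_congr rfl fun x' _ => ?_
      simp only [ite_mul, zero_mul, Finset.sum_ite_eq, Finset.mem_univ, if_true]
      by_cases hc : h s x = h s x'
      · simp [hc]
      · simp [hc, Ne.symm hc]
    have e3 : ∀ k, ((∑ x, if h s x = k then r x else 0) - R / m) ^ 2
        = (∑ x, if h s x = k then r x else 0) ^ 2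
          - 2 * (R / m) * (∑ x, if h s x = k then r x else 0) + (R / m) ^ 2 := fun k => by ring
    simp_rw [e3]
    rw [Finset.sum_add_distrib, Finset.sum_sub_distrib, ← Finset.mul_sum, e1, e2]
    simp only [Finset.sum_const, Finset.card_univ, nsmul_eq_mul, ← hm]
    field_simp
    ring
  simp_rw [h1]
  rw [Finset.sum_sub_distrib]
  have h2 : ∑ s, ∑ x, ∑ x', r x * r x' * (if h s x = h s x' then (1 : ℝ) else 0)
      = ∑ x, ∑ x', r x * r x' * ∑ s, (if h s x = h s x' then (1 : ℝ) else 0) := by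
    rw [Finset.sum_comm]
    refine Finset.sum_congr rfl fun x _ => ?_
    rw [Finset.sum_comm]
    refine Finset.sum_congr rfl fun x' _ => ?_
    rw [Finset.mul_sum]
  have h3 : ∑ x, ∑ x', r x * r x' * ∑ s, (if h s x = h s x' then (1 : ℝ) else 0)
      ≤ ∑ x, ∑ x', r x * r x' * (N / m + if x = x' then N else 0) := by
    refine Finset.sum_le_sum fun x _ => Finset.sum_le_sum fun x' _ => ?_
    refine mul_le_mul_of_nonneg_left ?_ (mul_nonneg (hr x) (hr x'))
    by_cases hx : x = x'
    · subst hx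
      simp only [if_true, Finset.sum_const, Finset.card_univ, nsmul_eq_mul, mul_one]
      have : 0 ≤ N / m := by positivity
      linarith
    · simpa [hx] using hh.sum_collision_le hx
  have h4 : ∑ x, ∑ x', r x * r x' * (N / m + if x = x' then N else 0)
      = R ^ 2 * (N / m) + N * ∑ x, r x ^ 2 := by
    simp_rw [mul_add, Finset.sum_add_distrib]
    congr 1
    · simp_rw [← Finset.sum_mul]
      rw [sq, hR, Finset.sum_mul_sum]
    · simp only [mul_ite, mul_zero, Finset.sum_ite_eq, Finset.mem_univ, if_true, Finset.mul_sum]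
      exact Finset.sum_congr rfl fun x _ => by ring
  rw [h2]
  simp only [Finset.sum_const, Finset.card_univ, nsmul_eq_mul, ← hN]
  have : N * (R ^ 2 / m) = R ^ 2 * (N / m) := by ring
  linarith

/-- The deviation from uniformity, at `(v, k)`, of the hash value `k = f x` jointly with the side
information `v = g x`, when `x` has the (unnormalised) weights `r`. -/
noncomputable def hashDeviation {α β V : Type*} [Fintype α] [Fintype β] (f : α → β) (g : α → V)
    (r : α → ℝ) (v : V) (k : β) : ℝ :=
  open Classical in
  (∑ x, if f x = k then (if g x = v then r x else 0) else 0)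
    - (∑ x, if g x = v then r x else 0) / Fintype.card β

theorem hashDeviation_add {α β V : Type*} [Fintype α] [Fintype β] (f : α → β) (g : α → V)
    (r r' : α → ℝ) (v : V) (k : β) :
    hashDeviation f g (r + r') v k = hashDeviation f g r v k + hashDeviation f g r' v k := by
  classical
  unfold hashDeviation
  have h1 : (∑ x, if g x = v then (r + r') x else 0)
      = (∑ x, if g x = v then r x else 0) + ∑ x, if g x = v then r' x else 0 := by
    rw [← Finset.sum_add_distrib]
    exact Finset.sum_congr rfl fun x _ => by split_ifs <;> simp
  have h2 : (∑ x, if f x = k then (if g x = v then (r + r') x else 0) else 0)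
      = (∑ x, if f x = k then (if g x = v then r x else 0) else 0)
        + ∑ x, if f x = k then (if g x = v then r' x else 0) else 0 := by
    rw [← Finset.sum_add_distrib]
    exact Finset.sum_congr rfl fun x _ => by split_ifs <;> simp
  rw [h1, h2]
  ring

/-- Triangle inequality, with no randomness in `f`. It serves for the weights that smoothing cuts
off. -/
theorem sum_abs_hashDeviation_le_two_mul {α β V : Type*} [Fintype α] [Fintype β] [Nonempty β]
    [Fintype V] (f : α → β) (g : α → V) (r : α → ℝ) (hr : ∀ x, 0 ≤ r x) :
    ∑ v, ∑ k, |hashDeviation f g r v k| ≤ 2 * ∑ x, r x := by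
  classical
  have hβ : (0 : ℝ) < Fintype.card β := by exact_mod_cast Fintype.card_pos
  have hv : ∀ v, ∑ k, |hashDeviation f g r v k| ≤ 2 * ∑ x, if g x = v then r x else 0 := by
    intro v
    have h0 : ∀ x, 0 ≤ if g x = v then r x else 0 := fun x => by
      split_ifs
      exacts [hr x, le_rfl]
    calc ∑ k, |hashDeviation f g r v k|
        ≤ ∑ k, ((∑ x, if f x = k then (if g x = v then r x else 0) else 0)
          + (∑ x, if g x = v then r x else 0) / Fintype.card β) := by
          refine Finset.sum_le_sum fun k _ => ?_
          unfold hashDeviation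
          refine (abs_sub _ _).trans (le_of_eq ?_)
          rw [abs_of_nonneg, abs_of_nonneg]
          · exact div_nonneg (Finset.sum_nonneg fun x _ => h0 x) hβ.le
          · refine Finset.sum_nonneg fun x _ => ?_
            split_ifs
            exacts [hr x, le_rfl, le_rfl]
      _ = _ := by
          rw [Finset.sum_add_distrib, Finset.sum_comm]
          simp only [Finset.sum_ite_eq, Finset.mem_univ, if_true, Finset.sum_const,
            Finset.card_univ, nsmul_eq_mul]
          field_simp
          ring
  refine (Finset.sum_le_sum fun v _ => hv v).trans (le_of_eq ?_)
  rw [← Finset.mul_sum, Finset.sum_comm]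
  simp

/-- The leftover hash lemma for unnormalised weights, with the side information `g x`. -/
theorem IsTwoUniversal.sum_abs_hashDeviation_le {S α β V : Type*} [Fintype S] [Nonempty S]
    [Fintype α] [Fintype β] [Nonempty β] [Fintype V] {h : S → α → β} (hh : IsTwoUniversal h)
    (g : α → V) (r : α → ℝ) (hr : ∀ x, 0 ≤ r x) :
    ∑ s, ∑ v, ∑ k, |hashDeviation (h s) g r v k|
      ≤ Fintype.card S * √(Fintype.card V * Fintype.card β * ∑ x, r x ^ 2) := by
  classical
  have hsq : ∑ s, ∑ v, ∑ k, hashDeviation (h s) g r v k ^ 2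
      ≤ Fintype.card S * ∑ x, r x ^ 2 := by
    rw [Finset.sum_comm]
    calc ∑ v, ∑ s, ∑ k, hashDeviation (h s) g r v k ^ 2
        ≤ ∑ v, (Fintype.card S * ∑ x, (if g x = v then r x else 0) ^ 2 : ℝ) := by
          refine Finset.sum_le_sum fun v _ => ?_
          refine hh.sum_sq_deviation_le (fun x => if g x = v then r x else 0) fun x => ?_
          split_ifs
          exacts [hr x, le_rfl]
      _ = _ := by
          rw [← Finset.mul_sum, Finset.sum_comm]
          simp
  -- Cauchy–Schwarz over all triples `(s, v, k)`; the number of triples is what makes the side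
  -- information cost a factor `|V|` under the root.
  have hcs : (∑ w : S × V × β, |hashDeviation (h w.1) g r w.2.1 w.2.2|) ^ 2
      ≤ Fintype.card (S × V × β)
        * ∑ w : S × V × β, hashDeviation (h w.1) g r w.2.1 w.2.2 ^ 2 := by
    have := sq_sum_le_card_mul_sum_sq (s := (Finset.univ : Finset (S × V × β)))
      (f := fun w => |hashDeviation (h w.1) g r w.2.1 w.2.2|)
    simpa only [sq_abs, Finset.card_univ] using this
  simp only [Fintype.sum_prod_type, Fintype.card_prod, Nat.cast_mul] at hcs
  have hN : (0 : ℝ) ≤ Fintype.card S := by positivity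
  rw [← Real.sqrt_sq hN, ← Real.sqrt_mul (by positivity)]
  refine Real.le_sqrt_of_sq_le (hcs.trans ?_)
  calc _ ≤ (Fintype.card S * (Fintype.card V * Fintype.card β)
          * (Fintype.card S * ∑ x, r x ^ 2) : ℝ) := by gcongr
    _ = _ := by ring

open Classical in
/-- The smoothed leftover hash lemma: the weights above `θ * ∑ x, r x` are cut off. -/
theorem IsTwoUniversal.sum_abs_hashDeviation_le_smooth {S α β V : Type*} [Fintype S] [Nonempty S]
    [Fintype α] [Fintype β] [Nonempty β] [Fintype V] {h : S → α → β} (hh : IsTwoUniversal h)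
    (g : α → V) (r : α → ℝ) (hr : ∀ x, 0 ≤ r x) {θ : ℝ} (hθ : 0 ≤ θ) :
    ∑ s, ∑ v, ∑ k, |hashDeviation (h s) g r v k|
      ≤ Fintype.card S * ((∑ x, r x) * √(Fintype.card V * Fintype.card β * θ)
        + 2 * ∑ x, if θ * ∑ x', r x' < r x then r x else 0) := by
  set w := ∑ x, r x with hw
  have hw0 : 0 ≤ w := Finset.sum_nonneg fun x _ => hr x
  set r₁ : α → ℝ := fun x => if θ * w < r x then 0 else r x with hr₁
  set r₂ : α → ℝ := fun x => if θ * w < r x then r x else 0 with hr₂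
  have h₁ : ∀ x, 0 ≤ r₁ x := fun x => by
    simp only [hr₁]; split_ifs
    exacts [le_rfl, hr x]
  have h₂ : ∀ x, 0 ≤ r₂ x := fun x => by
    simp only [hr₂]; split_ifs
    exacts [hr x, le_rfl]
  have hadd : r = r₁ + r₂ := by
    funext x
    simp only [hr₁, hr₂, Pi.add_apply]
    split_ifs <;> simp
  have hle : ∀ x, r₁ x ≤ r x := fun x => by
    simp only [hr₁]; split_ifs
    exacts [hr x, le_rfl]
  have hcap : ∀ x, r₁ x ≤ θ * w := fun x => by
    simp only [hr₁]; split_ifs with hx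
    exacts [by positivity, not_lt.1 hx]
  -- One factor of the square is bounded by the cap and the other summed to `w`: a bound on
  -- min-entropy gives one on collision probability.
  have hsq : ∑ x, r₁ x ^ 2 ≤ θ * w ^ 2 := by
    calc ∑ x, r₁ x ^ 2 ≤ ∑ x, θ * w * r x := by
          refine Finset.sum_le_sum fun x _ => ?_
          rw [sq]
          exact mul_le_mul (hcap x) (hle x) (h₁ x) (by positivity)
      _ = θ * w ^ 2 := by rw [← Finset.mul_sum, ← hw]; ring
  calc ∑ s, ∑ v, ∑ k, |hashDeviation (h s) g r v k|
      ≤ ∑ s, ∑ v, ∑ k, (|hashDeviation (h s) g r₁ v k| + |hashDeviation (h s) g r₂ v k|) := by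
        refine Finset.sum_le_sum fun s _ => Finset.sum_le_sum fun v _ =>
          Finset.sum_le_sum fun k _ => ?_
        rw [hadd, hashDeviation_add]
        exact abs_add_le _ _
    _ = ∑ s, ∑ v, ∑ k, |hashDeviation (h s) g r₁ v k|
        + ∑ s, ∑ v, ∑ k, |hashDeviation (h s) g r₂ v k| := by
        simp only [Finset.sum_add_distrib]
    _ ≤ Fintype.card S * √(Fintype.card V * Fintype.card β * ∑ x, r₁ x ^ 2)
        + ∑ s : S, 2 * ∑ x, r₂ x := by
        gcongr with s
        · exact hh.sum_abs_hashDeviation_le g r₁ h₁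
        · exact sum_abs_hashDeviation_le_two_mul (h s) g r₂ h₂
    _ ≤ Fintype.card S * √(Fintype.card V * Fintype.card β * (θ * w ^ 2))
        + ∑ s : S, 2 * ∑ x, r₂ x := by gcongr
    _ = _ := by
        have : (Fintype.card V * Fintype.card β * (θ * w ^ 2) : ℝ)
            = w ^ 2 * (Fintype.card V * Fintype.card β * θ) := by ring
        rw [this, Real.sqrt_mul (by positivity), Real.sqrt_sq hw0]
        simp only [Finset.sum_const, Finset.card_univ, nsmul_eq_mul]
        ring

/-- Only an inequality, because division by a zero marginal returns `0`. -/
theorem condPMF_sum_le_one {A B : Type*} [Fintype A] (p : A × B → ℝ) (y : B) :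
    ∑ x, condPMF p x y ≤ 1 := by
  unfold condPMF
  rw [← Finset.sum_div]
  exact div_self_le_one _

theorem condPMF_nonneg {A B : Type*} [Fintype A] {p : A × B → ℝ} (hp : ∀ w, 0 ≤ p w) (x : A)
    (y : B) : 0 ≤ condPMF p x y :=
  div_nonneg (hp _) (Finset.sum_nonneg fun _ _ => hp _)

theorem condPMF_le_one {A B : Type*} [Fintype A] {p : A × B → ℝ} (hp : ∀ w, 0 ≤ p w) (x : A)
    (y : B) : condPMF p x y ≤ 1 :=
  (Finset.single_le_sum (fun x' _ => condPMF_nonneg hp x' y) (Finset.mem_univ x)).trans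
    (condPMF_sum_le_one p y)

theorem condPMF_pos {A B : Type*} [Fintype A] {p : A × B → ℝ} (hp : ∀ w, 0 ≤ p w) {x : A}
    {y : B} (h : 0 < p (x, y)) : 0 < condPMF p x y :=
  div_pos h (h.trans_le
    (Finset.single_le_sum (f := fun x' => p (x', y)) (fun _ _ => hp _) (Finset.mem_univ x)))

open Classical in
theorem card_guessList_le {A B : Type*} [Fintype A] {p : A × B → ℝ} (hp : ∀ w, 0 ≤ p w)
    (lam : ℝ) (y : B) :
    ∑ x, (if x ∈ guessList p lam y then (1 : ℝ) else 0) ≤ 2 ^ lam := by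
  have h2 : (0 : ℝ) < 2 ^ lam := by positivity
  calc ∑ x, (if x ∈ guessList p lam y then (1 : ℝ) else 0)
      ≤ ∑ x, 2 ^ lam * condPMF p x y := by
        refine Finset.sum_le_sum fun x _ => ?_
        split_ifs with hx
        · obtain ⟨h0, h1⟩ := hx
          have h3 : (2 : ℝ) ^ (-lam) ≤ condPMF p x y := by
            rw [← Real.le_logb_iff_rpow_le (by norm_num) h0]
            linarith
          calc (1 : ℝ) = 2 ^ lam * 2 ^ (-lam) := by
                rw [← Real.rpow_add (by norm_num)]; simp
            _ ≤ _ := by gcongr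
        · exact mul_nonneg h2.le (condPMF_nonneg hp x y)
    _ ≤ 2 ^ lam * 1 := by
        rw [← Finset.mul_sum]
        gcongr
        exact condPMF_sum_le_one p y
    _ = _ := mul_one _

theorem reconcile_eq_some {A B V : Type*} [Fintype A] (p : A × B → ℝ) (lam : ℝ) (g : A → V)
    {x : A} {y : B} (hx : x ∈ guessList p lam y)
    (hu : ∀ x', x' ≠ x → x' ∈ guessList p lam y → g x' ≠ g x) :
    reconcile p lam g y (g x) = some x := by
  have he : ∃! x', x' ∈ guessList p lam y ∧ g x' = g x :=
    ⟨x, ⟨hx, rfl⟩, fun x' h => by_contra fun hne => hu x' hne h.1 h.2⟩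
  unfold reconcile
  rw [dif_pos he]
  exact congrArg some (he.unique he.choose_spec.1 ⟨hx, rfl⟩)

-- Union bound: when `x` is listed, reconciliation can fail only through another listed element with
-- the same hash, and the list has at most `2^lam` elements.
open Classical in
theorem IsTwoUniversal.sum_reconcile_fail_le {A B V S : Type*} [Fintype A] [Fintype V] [Fintype S]
    [Nonempty S] {h : S → A → V} (hh : IsTwoUniversal h) {p : A × B → ℝ} (hp : ∀ w, 0 ≤ p w)
    (lam : ℝ) {x : A} {y : B} (hx : x ∈ guessList p lam y) :
    ∑ s, (if reconcile p lam (h s) y (h s x) = some x then (0 : ℝ) else 1)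
      ≤ Fintype.card S * (2 ^ lam / Fintype.card V) := by
  calc ∑ s, (if reconcile p lam (h s) y (h s x) = some x then (0 : ℝ) else 1)
      ≤ ∑ s, ∑ x', (if x' ≠ x ∧ x' ∈ guessList p lam y ∧ h s x' = h s x then (1 : ℝ) else 0) := by
        refine Finset.sum_le_sum fun s _ => ?_
        have hnn : ∀ x' ∈ Finset.univ, (0 : ℝ) ≤
            (if x' ≠ x ∧ x' ∈ guessList p lam y ∧ h s x' = h s x then (1 : ℝ) else 0) :=
          fun x' _ => by split_ifs <;> norm_num
        by_cases hr : reconcile p lam (h s) y (h s x) = some x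
        · rw [if_pos hr]
          exact Finset.sum_nonneg hnn
        · rw [if_neg hr]
          obtain ⟨x', h1, h2, h3⟩ : ∃ x', x' ≠ x ∧ x' ∈ guessList p lam y ∧ h s x' = h s x := by
            by_contra! hcon
            exact hr (reconcile_eq_some p lam (h s) hx hcon)
          refine le_trans ?_ (Finset.single_le_sum hnn (Finset.mem_univ x'))
          rw [if_pos ⟨h1, h2, h3⟩]
    _ = ∑ x', if x' ≠ x ∧ x' ∈ guessList p lam y
          then ∑ s, (if h s x' = h s x then (1 : ℝ) else 0) else 0 := by
        rw [Finset.sum_comm]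
        refine Finset.sum_congr rfl fun x' _ => ?_
        by_cases h1 : x' ≠ x <;> by_cases h2 : x' ∈ guessList p lam y <;> simp [h1, h2]
    _ ≤ ∑ x', (Fintype.card S / Fintype.card V : ℝ)
          * (if x' ∈ guessList p lam y then (1 : ℝ) else 0) := by
        refine Finset.sum_le_sum fun x' _ => ?_
        by_cases h2 : x' ∈ guessList p lam y
        · by_cases h1 : x' = x
          · simp only [h1, ne_eq, not_true_eq_false, false_and, if_false]
            positivity
          · simpa [h1, h2] using hh.sum_collision_le h1
        · simp [h2]
    _ ≤ (Fintype.card S / Fintype.card V : ℝ) * 2 ^ lam := by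
        rw [← Finset.mul_sum]
        gcongr
        exact card_guessList_le hp lam y
    _ = _ := by ring

end OneShot

/-! ### Reliability and security of the protocol for an arbitrary source. -/

section SecretKey

theorem skaProtocol_jointPMF {A B C S S' V K : Type*} [Fintype A] [Fintype S] [Nonempty S]
    [Fintype S'] [Nonempty S'] (q : A × B → ℝ) (p : A × B × C → ℝ) (lam : ℝ) (h : S → A → V)
    (h' : S' → A → K) (ω : (A × B × C) × (S × S') × Unit) :
    (skaProtocol q lam h h').jointPMF p ω = p ω.1 / (Fintype.card S * Fintype.card S') := by
  simp [OneMessageProtocol.jointPMF, skaProtocol, uniformPMF, div_eq_mul_inv]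

variable {A B C S S' V K : Type*} [Fintype A] [Fintype B] [Fintype C] [Fintype S] [Nonempty S]
  [Fintype S'] [Nonempty S']

-- The keys agree whenever reconciliation returns `x`, so `δ` pays for `x` missing from the list and
-- the other term for hash collisions.
open Classical in
theorem skaProtocol_reliability [Fintype V] {p : A × B × C → ℝ}
    (hp : p ∈ stdSimplex ℝ (A × B × C)) {lam δ : ℝ} {h : S → A → V} (hh : IsTwoUniversal h)
    (h' : S' → A → K)
    (hδ : ∑ x, ∑ y, (if x ∈ guessList (margFst p) lam y then 0 else margFst p (x, y)) ≤ δ) :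
    1 - (δ + 2 ^ lam / Fintype.card V) ≤
      pmfProb ((skaProtocol (margFst p) lam h h').jointPMF p) (fun ω =>
        (skaProtocol (margFst p) lam h h').keyA ω.1.1 ω.2.1
            ((skaProtocol (margFst p) lam h h').publicF ω) = some (h' ω.2.1.2 ω.1.1) ∧
        (skaProtocol (margFst p) lam h h').keyB ω.1.2.1 ω.2.2
            ((skaProtocol (margFst p) lam h h').publicF ω) = some (h' ω.2.1.2 ω.1.1)) := by
  set q := margFst p with hq
  have hq0 : ∀ w, 0 ≤ q w := fun w => Finset.sum_nonneg fun c _ => hp.1 _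
  have hq1 : ∑ x, ∑ y, q (x, y) = 1 := by
    rw [← hp.2]
    simp only [Fintype.sum_prod_type, hq, margFst]
  have hS : (0 : ℝ) < Fintype.card S := by exact_mod_cast Fintype.card_pos
  have hS' : (0 : ℝ) < Fintype.card S' := by exact_mod_cast Fintype.card_pos
  set D : ℝ := 2 ^ lam / Fintype.card V with hD
  have hD0 : 0 ≤ D := by positivity
  have key : ∀ x y, q (x, y) - ((if x ∈ guessList q lam y then 0 else q (x, y)) + q (x, y) * D)
      ≤ q (x, y) * ((∑ s, if reconcile q lam (h s) y (h s x) = some x then (1 : ℝ) else 0)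
        / Fintype.card S) := by
    intro x y
    by_cases hx : x ∈ guessList q lam y
    · have h1 := hh.sum_reconcile_fail_le hq0 lam hx
      have h2 : ∑ s, (if reconcile q lam (h s) y (h s x) = some x then (0 : ℝ) else 1)
          = Fintype.card S
            - ∑ s, (if reconcile q lam (h s) y (h s x) = some x then (1 : ℝ) else 0) := by
        rw [eq_sub_iff_add_eq, ← Finset.sum_add_distrib]
        rw [← Finset.card_univ, Finset.cast_card]
        exact Finset.sum_congr rfl fun s _ => by split_ifs <;> simp
      rw [h2] at h1
      rw [if_pos hx]
      have h3 : 1 - D ≤ (∑ s, if reconcile q lam (h s) y (h s x) = some x then (1 : ℝ) else 0)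
          / Fintype.card S := by
        rw [le_div_iff₀ hS]
        linarith
      have := mul_le_mul_of_nonneg_left h3 (hq0 (x, y))
      linarith
    · rw [if_neg hx]
      have h1 : 0 ≤ q (x, y) * D := mul_nonneg (hq0 _) hD0
      have h2 : 0 ≤ q (x, y)
          * ((∑ s, if reconcile q lam (h s) y (h s x) = some x then (1 : ℝ) else 0)
            / Fintype.card S) := by
        refine mul_nonneg (hq0 _) (div_nonneg (Finset.sum_nonneg fun s _ => ?_) hS.le)
        split_ifs <;> norm_num
      linarith
  calc 1 - (δ + D)
      ≤ ∑ x, ∑ y,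
        (q (x, y) - ((if x ∈ guessList q lam y then 0 else q (x, y)) + q (x, y) * D)) := by
        simp only [Finset.sum_sub_distrib, Finset.sum_add_distrib, ← Finset.sum_mul, hq1]
        linarith
    _ ≤ ∑ x, ∑ y, q (x, y)
        * ((∑ s, if reconcile q lam (h s) y (h s x) = some x then (1 : ℝ) else 0)
          / Fintype.card S) :=
        Finset.sum_le_sum fun x _ => Finset.sum_le_sum fun y _ => key x y
    _ = ∑ x, ∑ y, ∑ z, ∑ s, ∑ s' : S', p (x, y, z) / (Fintype.card S * Fintype.card S')
          * (if reconcile q lam (h s) y (h s x) = some x then (1 : ℝ) else 0) := by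
        refine Finset.sum_congr rfl fun x _ => Finset.sum_congr rfl fun y _ => ?_
        simp only [hq, margFst, Finset.sum_mul]
        refine Finset.sum_congr rfl fun z _ => ?_
        simp only [Finset.sum_const, Finset.card_univ, nsmul_eq_mul, ← Finset.mul_sum]
        field_simp
    _ ≤ _ := by
        unfold pmfProb
        simp only [Fintype.sum_prod_type, Finset.univ_unique, Finset.sum_singleton]
        refine Finset.sum_le_sum fun x _ => Finset.sum_le_sum fun y _ =>
          Finset.sum_le_sum fun z _ => Finset.sum_le_sum fun s _ =>
          Finset.sum_le_sum fun s' _ => ?_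
        rw [skaProtocol_jointPMF]
        by_cases hr : reconcile q lam (h s) y (h s x) = some x
        · rw [if_pos hr, if_pos, mul_one]
          exact ⟨rfl, by simp [skaProtocol, OneMessageProtocol.publicF, hr]⟩
        · rw [if_neg hr, mul_zero]
          split_ifs
          · exact div_nonneg (hp.1 _) (by positivity)
          · exact le_rfl

theorem skaProtocol_law_key_public_side (q : A × B → ℝ) (p : A × B × C → ℝ) (lam : ℝ)
    (h : S → A → V) (h' : S' → A → K) (k : K) (v : V) (s : S) (s' : S') (z : C) :
    pmfLaw ((skaProtocol q lam h h').jointPMF p)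
        (fun ω => (h' ω.2.1.2 ω.1.1, (skaProtocol q lam h h').publicF ω, ω.1.2.2))
        (k, (v, s, s'), z)
      = (open Classical in
        (∑ x, if h' s' x = k then (if h s x = v then margSnd p (x, z) else 0) else 0))
          / (Fintype.card S * Fintype.card S') := by
  classical
  unfold pmfLaw pmfProb
  simp only [Fintype.sum_prod_type, Finset.univ_unique, Finset.sum_singleton,
    skaProtocol_jointPMF]
  rw [Finset.sum_div]
  refine Finset.sum_congr rfl fun x _ => ?_
  simp only [OneMessageProtocol.publicF, skaProtocol, Prod.mk.injEq]
  have e1 : ∀ (y : B) (z' : C) (s₁ : S) (s₁' : S'),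
      (if h' s₁' x = k ∧ (h s₁ x = v ∧ s₁ = s ∧ s₁' = s') ∧ z' = z
        then p (x, y, z') / (Fintype.card S * Fintype.card S' : ℝ) else 0)
      = if s₁' = s' then (if s₁ = s then (if z' = z then
          (if h' s' x = k then (if h s x = v then
            p (x, y, z) / (Fintype.card S * Fintype.card S' : ℝ) else 0) else 0)
          else 0) else 0) else 0 := by
    intro y z' s₁ s₁'
    by_cases h1 : s₁' = s'
    · by_cases h2 : s₁ = s
      · by_cases h3 : z' = z
        · subst h1 h2 h3
          by_cases h4 : h' s₁' x = k <;> by_cases h5 : h s₁ x = v <;> simp [h4, h5]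
        · simp [h3]
      · simp [h2]
    · simp [h1]
  simp only [e1, Finset.sum_ite_eq', Finset.mem_univ, if_true]
  split_ifs
  · simp only [margSnd, Finset.sum_div]
  · simp
  · simp

theorem skaProtocol_law_public_side (q : A × B → ℝ) (p : A × B × C → ℝ) (lam : ℝ)
    (h : S → A → V) (h' : S' → A → K) (v : V) (s : S) (s' : S') (z : C) :
    pmfLaw ((skaProtocol q lam h h').jointPMF p)
        (fun ω => ((skaProtocol q lam h h').publicF ω, ω.1.2.2)) ((v, s, s'), z)
      = (open Classical in (∑ x, if h s x = v then margSnd p (x, z) else 0))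
          / (Fintype.card S * Fintype.card S') := by
  classical
  unfold pmfLaw pmfProb
  simp only [Fintype.sum_prod_type, Finset.univ_unique, Finset.sum_singleton,
    skaProtocol_jointPMF]
  rw [Finset.sum_div]
  refine Finset.sum_congr rfl fun x _ => ?_
  simp only [OneMessageProtocol.publicF, skaProtocol, Prod.mk.injEq]
  have e1 : ∀ (y : B) (z' : C) (s₁ : S) (s₁' : S'),
      (if (h s₁ x = v ∧ s₁ = s ∧ s₁' = s') ∧ z' = z
        then p (x, y, z') / (Fintype.card S * Fintype.card S' : ℝ) else 0)
      = if s₁' = s' then (if s₁ = s then (if z' = z then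
          (if h s x = v then
            p (x, y, z) / (Fintype.card S * Fintype.card S' : ℝ) else 0)
          else 0) else 0) else 0 := by
    intro y z' s₁ s₁'
    by_cases h1 : s₁' = s'
    · by_cases h2 : s₁ = s
      · by_cases h3 : z' = z
        · subst h1 h2 h3
          by_cases h5 : h s₁ x = v <;> simp [h5]
        · simp [h3]
      · simp [h2]
    · simp [h1]
  simp only [e1, Finset.sum_ite_eq', Finset.mem_univ, if_true]
  split_ifs
  · simp only [margSnd, Finset.sum_div]
  · simp

-- Both seeds are public and independent of the source. Smoothed leftover hashing therefore applies
-- for each fixed `z` and `s`, with `h s x` as side information, and the bounds are averaged. The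
-- factor `1/2` of statistical distance turns the `2δ` of smoothing into `δ`.
open Classical in
theorem skaProtocol_security [Fintype V] [Fintype K] [Nonempty K] {p : A × B × C → ℝ}
    (hp : p ∈ stdSimplex ℝ (A × B × C)) (q : A × B → ℝ) (lam : ℝ) {θ δ : ℝ} (hθ : 0 ≤ θ)
    (h : S → A → V) {h' : S' → A → K} (hh' : IsTwoUniversal h')
    (hδ : ∑ x, ∑ z, (if θ * ∑ x', margSnd p (x', z) < margSnd p (x, z)
      then margSnd p (x, z) else 0) ≤ δ) :
    statDist
      (pmfLaw ((skaProtocol q lam h h').jointPMF p)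
        (fun ω => (h' ω.2.1.2 ω.1.1, (skaProtocol q lam h h').publicF ω, ω.1.2.2)))
      (fun w : K × (V × S × S') × C => uniformPMF K w.1 *
        pmfLaw ((skaProtocol q lam h h').jointPMF p)
          (fun ω => ((skaProtocol q lam h h').publicF ω, ω.1.2.2)) w.2)
      ≤ δ + 1 / 2 * √(Fintype.card V * Fintype.card K * θ) := by
  set r := margSnd p with hr
  have hr0 : ∀ w, 0 ≤ r w := fun w => Finset.sum_nonneg fun b _ => hp.1 _
  have hr1 : ∑ z, ∑ x, r (x, z) = 1 := by
    rw [← hp.2, Finset.sum_comm]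
    simp only [Fintype.sum_prod_type, hr, margSnd]
    exact Finset.sum_congr rfl fun x _ => Finset.sum_comm
  have hS : (0 : ℝ) < Fintype.card S := by exact_mod_cast Fintype.card_pos
  have hS' : (0 : ℝ) < Fintype.card S' := by exact_mod_cast Fintype.card_pos
  unfold statDist
  have e1 : ∑ w : K × (V × S × S') × C,
      |pmfLaw ((skaProtocol q lam h h').jointPMF p)
          (fun ω => (h' ω.2.1.2 ω.1.1, (skaProtocol q lam h h').publicF ω, ω.1.2.2)) w
        - uniformPMF K w.1 * pmfLaw ((skaProtocol q lam h h').jointPMF p)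
          (fun ω => ((skaProtocol q lam h h').publicF ω, ω.1.2.2)) w.2|
      = (∑ z, ∑ s, ∑ s', ∑ v, ∑ k, |hashDeviation (h' s') (h s) (fun x => r (x, z)) v k|)
        / (Fintype.card S * Fintype.card S') := by
    rw [Finset.sum_div]
    simp only [Fintype.sum_prod_type]
    have e2 : ∀ k v s s' z, |pmfLaw ((skaProtocol q lam h h').jointPMF p)
          (fun ω => (h' ω.2.1.2 ω.1.1, (skaProtocol q lam h h').publicF ω, ω.1.2.2))
            (k, (v, s, s'), z)
        - uniformPMF K k * pmfLaw ((skaProtocol q lam h h').jointPMF p)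
          (fun ω => ((skaProtocol q lam h h').publicF ω, ω.1.2.2)) ((v, s, s'), z)|
        = |hashDeviation (h' s') (h s) (fun x => r (x, z)) v k|
          / (Fintype.card S * Fintype.card S') := by
      intro k v s s' z
      rw [skaProtocol_law_key_public_side, skaProtocol_law_public_side, hashDeviation]
      conv_rhs => rw [← abs_of_pos (mul_pos hS hS'), ← abs_div]
      congr 1
      simp only [uniformPMF, ← hr]
      ring
    simp only [e2]
    calc _ = ∑ w : K × V × S × S' × C,
          |hashDeviation (h' w.2.2.2.1) (h w.2.2.1) (fun x => r (x, w.2.2.2.2)) w.2.1 w.1|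
            / (Fintype.card S * Fintype.card S' : ℝ) := by
          simp only [Fintype.sum_prod_type]
      _ = ∑ w : C × S × S' × V × K,
          |hashDeviation (h' w.2.2.1) (h w.2.1) (fun x => r (x, w.1)) w.2.2.2.1 w.2.2.2.2|
            / (Fintype.card S * Fintype.card S' : ℝ) := by
          refine Fintype.sum_equiv
            ⟨fun w => (w.2.2.2.2, w.2.2.1, w.2.2.2.1, w.2.1, w.1),
             fun w => (w.2.2.2.2, w.2.2.2.1, w.2.1, w.2.2.1, w.1),
             fun _ => rfl, fun _ => rfl⟩ _ _ fun _ => rfl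
      _ = _ := by
          simp only [Fintype.sum_prod_type, Finset.sum_div]
  rw [e1]
  have e3 : ∑ z, ∑ s, ∑ s', ∑ v, ∑ k, |hashDeviation (h' s') (h s) (fun x => r (x, z)) v k|
      ≤ ∑ z, ∑ s : S, Fintype.card S' *
        ((∑ x, r (x, z)) * √(Fintype.card V * Fintype.card K * θ)
        + 2 * ∑ x, if θ * ∑ x', r (x', z) < r (x, z) then r (x, z) else 0) :=
    Finset.sum_le_sum fun z _ => Finset.sum_le_sum fun s _ =>
      hh'.sum_abs_hashDeviation_le_smooth (h s) (fun x => r (x, z)) (fun x => hr0 _) hθ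
  have e4 : ∑ z, ∑ s : S, Fintype.card S' *
        ((∑ x, r (x, z)) * √(Fintype.card V * Fintype.card K * θ)
        + 2 * ∑ x, if θ * ∑ x', r (x', z) < r (x, z) then r (x, z) else 0)
      = Fintype.card S * Fintype.card S' * (√(Fintype.card V * Fintype.card K * θ)
        + 2 * ∑ x, ∑ z, if θ * ∑ x', r (x', z) < r (x, z) then r (x, z) else 0) := by
    simp only [Finset.sum_const, Finset.card_univ, nsmul_eq_mul, ← Finset.mul_sum,
      Finset.sum_add_distrib, ← Finset.sum_mul, hr1]
    rw [Finset.sum_comm (γ := A)]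
    ring
  rw [e4] at e3
  rw [← div_le_iff₀' (by positivity)] at e3
  linarith

end SecretKey

/-! ### Exponential moments of the surprisal of one pair. -/

section SingleLetter

theorem Real.exp_le_cubic {x : ℝ} (hx : 0 ≤ x) :
    Real.exp x ≤ 1 + x + x ^ 2 / 2 + x ^ 3 * Real.exp x := by
  have h := Complex.norm_exp_sub_sum_le_norm_mul_exp (x : ℂ) 3
  have e : Complex.exp (x : ℂ) - ∑ m ∈ Finset.range 3, (x : ℂ) ^ m / (m.factorial : ℂ)
      = ((Real.exp x - (1 + x + x ^ 2 / 2) : ℝ) : ℂ) := by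
    simp [Finset.sum_range_succ]
  rw [e, Complex.norm_real, Complex.norm_real, Real.norm_eq_abs, Real.norm_eq_abs,
    abs_of_nonneg hx] at h
  have := (le_abs_self _).trans h
  linarith

/-- Invert `1 + x + x²/2 ≤ exp x` and use `(1 + x + x²/2)(1 - x + x²/2) = 1 + x⁴/4`. -/
theorem Real.exp_neg_le_quadratic {x : ℝ} (hx : 0 ≤ x) :
    Real.exp (-x) ≤ 1 - x + x ^ 2 / 2 := by
  have h := Real.quadratic_le_exp_of_nonneg hx
  have hp : 0 < 1 + x + x ^ 2 / 2 := by positivity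
  rw [Real.exp_neg]
  refine (inv_anti₀ hp h).trans ?_
  rw [inv_le_iff_one_le_mul₀ hp]
  nlinarith [sq_nonneg (x ^ 2)]

/-- The derivative `2 log t / t` decreases only from `e` on. Shifting by `3 > e` to stay in this
range is the origin of the `+ 3` in `log(|𝒳| + 3)`. -/
theorem concaveOn_log_sq : ConcaveOn ℝ (Set.Ici (3 : ℝ)) fun t => Real.log t ^ 2 := by
  have hd : ∀ t : ℝ, 0 < t → HasDerivAt (fun t => Real.log t ^ 2) (2 * (Real.log t / t)) t := by
    intro t ht
    refine ((Real.hasDerivAt_log ht.ne').pow 2).congr_deriv ?_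
    rw [div_eq_mul_inv]
    norm_num
    ring
  refine AntitoneOn.concaveOn_of_deriv (convex_Ici 3) ?_ ?_ ?_
  · intro t ht
    exact (hd t (by linarith [Set.mem_Ici.1 ht])).continuousAt.continuousWithinAt
  · intro t ht
    rw [interior_Ici] at ht
    exact (hd t (by linarith [Set.mem_Ioi.1 ht])).differentiableAt.differentiableWithinAt
  · intro a ha b hb hab
    rw [interior_Ici] at ha hb
    have ha' := Set.mem_Ioi.1 ha
    have hb' := Set.mem_Ioi.1 hb
    rw [(hd a (by linarith)).deriv, (hd b (by linarith)).deriv]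
    have he := Real.exp_one_lt_d9
    have := Real.log_div_self_antitoneOn (Set.mem_Ici.2 (by linarith : Real.exp 1 ≤ a))
      (Set.mem_Ici.2 (by linarith : Real.exp 1 ≤ b)) hab
    simp only at this
    linarith

/-- The conditional surprisal `-log P_{A|B}(a|b)`, in nats. -/
noncomputable def surprisal {A B : Type*} [Fintype A] (q : A × B → ℝ) (w : A × B) : ℝ :=
  -Real.log (condPMF q w.1 w.2)

/-- The mean of the conditional surprisal, i.e. the conditional entropy in nats. -/
noncomputable def meanSurprisal {A B : Type*} [Fintype A] [Fintype B] (q : A × B → ℝ) : ℝ :=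
  ∑ w, q w * surprisal q w

variable {A B : Type*} [Fintype A] [Fintype B] {q : A × B → ℝ}

theorem condEntropy_eq_meanSurprisal (q : A × B → ℝ) :
    condEntropy q = meanSurprisal q / Real.log 2 := by
  unfold condEntropy meanSurprisal surprisal
  rw [Fintype.sum_prod_type, Finset.sum_div, ← Finset.sum_neg_distrib]
  refine Finset.sum_congr rfl fun a _ => ?_
  rw [Finset.sum_div, ← Finset.sum_neg_distrib]
  refine Finset.sum_congr rfl fun b _ => ?_
  simp only [Real.logb]
  ring

theorem surprisal_nonneg {B : Type*} {q : A × B → ℝ} (hq : ∀ w, 0 ≤ q w) (w : A × B) :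
    0 ≤ surprisal q w := by
  unfold surprisal
  rw [neg_nonneg]
  exact Real.log_nonpos (condPMF_nonneg hq _ _) (condPMF_le_one hq _ _)

theorem meanSurprisal_nonneg (hq : ∀ w, 0 ≤ q w) : 0 ≤ meanSurprisal q :=
  Finset.sum_nonneg fun w _ => mul_nonneg (hq w) (surprisal_nonneg hq w)

/-- On the support `q(a,b) / q(a|b)` is the marginal of `b`; summing it over `b` and then `a` gives
`|A|`. -/
theorem mean_exp_surprisal_le (hq : q ∈ stdSimplex ℝ (A × B)) :
    ∑ w, q w * Real.exp (surprisal q w) ≤ Fintype.card A := by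
  calc ∑ w, q w * Real.exp (surprisal q w)
      ≤ ∑ w : A × B, ∑ a, q (a, w.2) := by
        refine Finset.sum_le_sum fun w _ => ?_
        rcases (hq.1 w).eq_or_lt with h0 | h0
        · rw [← h0, zero_mul]
          exact Finset.sum_nonneg fun a _ => hq.1 _
        · have hc : 0 < condPMF q w.1 w.2 := condPMF_pos hq.1 h0
          unfold surprisal
          rw [Real.exp_neg, Real.exp_log hc, condPMF, inv_div]
          rw [mul_div_cancel₀ _ h0.ne']
    _ = Fintype.card A := by
        rw [Fintype.sum_prod_type]
        simp only [Finset.sum_const, Finset.card_univ, nsmul_eq_mul]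
        rw [Finset.sum_comm, ← Fintype.sum_prod_type (f := fun w => q w), hq.2, mul_one]

theorem meanSurprisal_le (hq : q ∈ stdSimplex ℝ (A × B)) :
    meanSurprisal q ≤ Fintype.card A := by
  refine le_trans ?_ (mean_exp_surprisal_le hq)
  refine Finset.sum_le_sum fun w _ => mul_le_mul_of_nonneg_left ?_ (hq.1 w)
  linarith [Real.add_one_le_exp (surprisal q w)]

/-- Jensen for `log²` applied to `exp(surprisal) + 3`, whose mean is at most `|A| + 3`. -/
theorem mean_surprisal_sq_le (hq : q ∈ stdSimplex ℝ (A × B)) :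
    ∑ w, q w * surprisal q w ^ 2 ≤ Real.log (Fintype.card A + 3) ^ 2 := by
  have hv := surprisal_nonneg hq.1
  have hmean : ∑ w, q w * (Real.exp (surprisal q w) + 3) ≤ Fintype.card A + 3 := by
    simp only [mul_add, Finset.sum_add_distrib, ← Finset.sum_mul, hq.2]
    linarith [mean_exp_surprisal_le hq]
  have hmean3 : 3 ≤ ∑ w, q w * (Real.exp (surprisal q w) + 3) := by
    simp only [mul_add, Finset.sum_add_distrib, ← Finset.sum_mul, hq.2]
    have : 0 ≤ ∑ w, q w * Real.exp (surprisal q w) :=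
      Finset.sum_nonneg fun w _ => mul_nonneg (hq.1 w) (Real.exp_pos _).le
    linarith
  have hj := concaveOn_log_sq.le_map_sum (t := Finset.univ) (w := q)
    (p := fun w => Real.exp (surprisal q w) + 3) (fun w _ => hq.1 w) hq.2
    (fun w _ => Set.mem_Ici.2 (by linarith [Real.exp_pos (surprisal q w)]))
  simp only [smul_eq_mul] at hj
  calc ∑ w, q w * surprisal q w ^ 2
      ≤ ∑ w, q w * Real.log (Real.exp (surprisal q w) + 3) ^ 2 := by
        refine Finset.sum_le_sum fun w _ => mul_le_mul_of_nonneg_left ?_ (hq.1 w)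
        refine pow_le_pow_left₀ (hv w) ?_ 2
        rw [Real.le_log_iff_exp_le (by positivity)]
        linarith
    _ ≤ _ := hj
    _ ≤ _ := by
        refine pow_le_pow_left₀ (Real.log_nonneg (by linarith)) ?_ 2
        exact Real.log_le_log (by linarith) hmean

/-- A Taylor expansion to second order, with the uncentred second moment in place of the variance.
The surprisal is unbounded, so the cubic remainder is controlled by the exponential moment. -/
theorem mgf_surprisal_le (hq : q ∈ stdSimplex ℝ (A × B)) {s : ℝ} (hs0 : 0 ≤ s)
    (hs : s ≤ 1 / 2) :
    ∑ w, q w * Real.exp (s * surprisal q w) ≤ Real.exp (s * meanSurprisal q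
      + (s ^ 2 / 2 * Real.log (Fintype.card A + 3) ^ 2 + 48 * Fintype.card A * s ^ 3)) := by
  have hv := surprisal_nonneg hq.1
  calc ∑ w, q w * Real.exp (s * surprisal q w)
      ≤ ∑ w, (q w + s * (q w * surprisal q w) + s ^ 2 / 2 * (q w * surprisal q w ^ 2)
        + 48 * s ^ 3 * (q w * Real.exp (surprisal q w))) := by
        refine Finset.sum_le_sum fun w _ => ?_
        have h1 := Real.exp_le_cubic (mul_nonneg hs0 (hv w))
        -- From `(v/2)³/3! ≤ exp(v/2)`, with `48 = 2³ · 3!`. The other half of `exp v` is kept for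
        -- `exp(s v)`, which is why `s ≤ 1/2`.
        have h2 : surprisal q w ^ 3 ≤ 48 * Real.exp (surprisal q w / 2) := by
          have := Real.pow_div_factorial_le_exp _ (div_nonneg (hv w) zero_le_two) 3
          norm_num [Nat.factorial] at this
          linarith
        have h3 : Real.exp (s * surprisal q w) ≤ Real.exp (surprisal q w / 2) := by
          refine Real.exp_le_exp.2 ?_
          nlinarith [hv w]
        have h4 : surprisal q w ^ 3 * Real.exp (s * surprisal q w)
            ≤ 48 * Real.exp (surprisal q w) := by
          calc _ ≤ 48 * Real.exp (surprisal q w / 2) * Real.exp (surprisal q w / 2) := by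
                gcongr
            _ = _ := by rw [mul_assoc, ← Real.exp_add, add_halves]
        have h5 := mul_le_mul_of_nonneg_left h4 (pow_nonneg hs0 3)
        calc q w * Real.exp (s * surprisal q w)
            ≤ q w * (1 + s * surprisal q w + (s * surprisal q w) ^ 2 / 2
              + s ^ 3 * (48 * Real.exp (surprisal q w))) := by
              refine mul_le_mul_of_nonneg_left (h1.trans ?_) (hq.1 w)
              rw [mul_pow s _ 3, mul_assoc (s ^ 3)]
              linarith
          _ = _ := by ring
    _ = 1 + s * meanSurprisal q + s ^ 2 / 2 * (∑ w, q w * surprisal q w ^ 2)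
        + 48 * s ^ 3 * ∑ w, q w * Real.exp (surprisal q w) := by
        simp only [Finset.sum_add_distrib, ← Finset.mul_sum, hq.2, meanSurprisal]
    _ ≤ 1 + s * meanSurprisal q + s ^ 2 / 2 * Real.log (Fintype.card A + 3) ^ 2
        + 48 * s ^ 3 * Fintype.card A := by
        gcongr
        · exact mean_surprisal_sq_le hq
        · exact mean_exp_surprisal_le hq
    _ = (s * meanSurprisal q + (s ^ 2 / 2 * Real.log (Fintype.card A + 3) ^ 2
        + 48 * Fintype.card A * s ^ 3)) + 1 := by ring
    _ ≤ _ := Real.add_one_le_exp _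

/-- For a negative exponent the quadratic bound is exact, so no cubic term appears and `s` may be
arbitrarily large. -/
theorem mgf_neg_surprisal_le (hq : q ∈ stdSimplex ℝ (A × B)) {s : ℝ} (hs0 : 0 ≤ s) :
    ∑ w, q w * Real.exp (-s * surprisal q w) ≤ Real.exp (-s * meanSurprisal q
      + s ^ 2 / 2 * Real.log (Fintype.card A + 3) ^ 2) := by
  have hv := surprisal_nonneg hq.1
  calc ∑ w, q w * Real.exp (-s * surprisal q w)
      ≤ ∑ w, (q w - s * (q w * surprisal q w) + s ^ 2 / 2 * (q w * surprisal q w ^ 2)) := by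
        refine Finset.sum_le_sum fun w _ => ?_
        have h1 := Real.exp_neg_le_quadratic (mul_nonneg hs0 (hv w))
        rw [neg_mul]
        calc _ ≤ q w * (1 - s * surprisal q w + (s * surprisal q w) ^ 2 / 2) :=
              mul_le_mul_of_nonneg_left h1 (hq.1 w)
          _ = _ := by ring
    _ = 1 - s * meanSurprisal q + s ^ 2 / 2 * (∑ w, q w * surprisal q w ^ 2) := by
        simp only [Finset.sum_add_distrib, Finset.sum_sub_distrib, ← Finset.mul_sum, hq.2,
          meanSurprisal]
    _ ≤ 1 - s * meanSurprisal q + s ^ 2 / 2 * Real.log (Fintype.card A + 3) ^ 2 := by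
        gcongr
        exact mean_surprisal_sq_le hq
    _ = (-s * meanSurprisal q + s ^ 2 / 2 * Real.log (Fintype.card A + 3) ^ 2) + 1 := by ring
    _ ≤ _ := Real.add_one_le_exp _

end SingleLetter

/-! ### Independent sources: additivity of the surprisal and the Chernoff bound. -/

section Product

variable {A B C : Type*} {n : ℕ}

/-- The joint pmf of independent, not necessarily identically distributed, pairs. -/
noncomputable def prodPMF (Q : Fin n → A × B → ℝ) : (Fin n → A) × (Fin n → B) → ℝ :=
  fun w => ∏ j, Q j (w.1 j, w.2 j)

theorem sum_prod_pi {A : Type*} [Fintype A] (f : Fin n → A → ℝ) :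
    ∑ x : Fin n → A, ∏ j, f j (x j) = ∏ j, ∑ a, f j a := by
  classical
  rw [Finset.prod_univ_sum, Fintype.piFinset_univ]

theorem sum_prod_pi_pair [Fintype A] [Fintype B] (f : Fin n → A × B → ℝ) :
    ∑ w : (Fin n → A) × (Fin n → B), ∏ j, f j (w.1 j, w.2 j) = ∏ j, ∑ u, f j u := by
  rw [← sum_prod_pi]
  exact Fintype.sum_equiv (Equiv.arrowProdEquivProdArrow (Fin n) (fun _ => A) (fun _ => B)).symm
    _ _ fun w => rfl

theorem margFst_productSource [Fintype C] (P : Fin n → A × B × C → ℝ) :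
    margFst (productSource P) = prodPMF fun j => margFst (P j) := by
  funext w
  exact sum_prod_pi fun j c => P j (w.1 j, w.2 j, c)

theorem margSnd_productSource [Fintype B] (P : Fin n → A × B × C → ℝ) :
    margSnd (productSource P) = prodPMF fun j => margSnd (P j) := by
  funext w
  exact sum_prod_pi fun j b => P j (w.1 j, b, w.2 j)

theorem margFst_mem [Fintype A] [Fintype B] [Fintype C] {p : A × B × C → ℝ}
    (hp : p ∈ stdSimplex ℝ (A × B × C)) : margFst p ∈ stdSimplex ℝ (A × B) := by
  refine ⟨fun w => Finset.sum_nonneg fun _ _ => hp.1 _, ?_⟩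
  rw [← hp.2]
  simp only [Fintype.sum_prod_type, margFst]

theorem margSnd_mem [Fintype A] [Fintype B] [Fintype C] {p : A × B × C → ℝ}
    (hp : p ∈ stdSimplex ℝ (A × B × C)) : margSnd p ∈ stdSimplex ℝ (A × C) := by
  refine ⟨fun w => Finset.sum_nonneg fun _ _ => hp.1 _, ?_⟩
  rw [← hp.2]
  simp only [Fintype.sum_prod_type, margSnd]
  exact Finset.sum_congr rfl fun x _ => Finset.sum_comm

theorem productSource_mem [Fintype A] [Fintype B] [Fintype C] {P : Fin n → A × B × C → ℝ}
    (hP : ∀ j, P j ∈ stdSimplex ℝ (A × B × C)) :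
    productSource P ∈ stdSimplex ℝ ((Fin n → A) × (Fin n → B) × (Fin n → C)) := by
  refine ⟨fun w => Finset.prod_nonneg fun j _ => (hP j).1 _, ?_⟩
  have h := sum_prod_pi_pair (n := n) fun j (u : A × B) => margFst (P j) u
  simp only [(margFst_mem (hP _)).2, Finset.prod_const_one] at h
  rw [← h]
  have e := margFst_productSource P
  calc _ = ∑ w, margFst (productSource P) w := by
        simp only [Fintype.sum_prod_type, margFst]
    _ = _ := by rw [e]; rfl

variable [Fintype A] [Fintype B] {Q : Fin n → A × B → ℝ}

theorem prodPMF_nonneg {A B : Type*} {Q : Fin n → A × B → ℝ} (hQ : ∀ j w, 0 ≤ Q j w)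
    (w : (Fin n → A) × (Fin n → B)) : 0 ≤ prodPMF Q w :=
  Finset.prod_nonneg fun j _ => hQ j _

theorem condPMF_prodPMF {B : Type*} (Q : Fin n → A × B → ℝ) (x : Fin n → A) (y : Fin n → B) :
    condPMF (prodPMF Q) x y = ∏ j, condPMF (Q j) (x j) (y j) := by
  unfold condPMF
  rw [Finset.prod_div_distrib, ← sum_prod_pi fun j a => Q j (a, y j)]
  rfl

/-- Restricted to the support because the logarithm of a product splits only when no factor
vanishes. -/
theorem surprisal_prodPMF {B : Type*} {Q : Fin n → A × B → ℝ} (hQ : ∀ j w, 0 ≤ Q j w)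
    {w : (Fin n → A) × (Fin n → B)} (hw : prodPMF Q w ≠ 0) :
    surprisal (prodPMF Q) w = ∑ j, surprisal (Q j) (w.1 j, w.2 j) := by
  unfold surprisal
  rw [condPMF_prodPMF, Real.log_prod, Finset.sum_neg_distrib]
  intro j _
  refine (condPMF_pos (hQ j) ?_).ne'
  exact (hQ j _).lt_of_ne' (Finset.prod_ne_zero_iff.1 hw j (Finset.mem_univ j))

theorem meanSurprisal_prodPMF (hQ : ∀ j, Q j ∈ stdSimplex ℝ (A × B)) :
    meanSurprisal (prodPMF Q) = ∑ j, meanSurprisal (Q j) := by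
  classical
  unfold meanSurprisal
  calc ∑ w, prodPMF Q w * surprisal (prodPMF Q) w
      = ∑ w, ∑ j, prodPMF Q w * surprisal (Q j) (w.1 j, w.2 j) := by
        refine Finset.sum_congr rfl fun w _ => ?_
        by_cases hw : prodPMF Q w = 0
        · simp [hw]
        · rw [surprisal_prodPMF (fun j => (hQ j).1) hw, Finset.mul_sum]
    _ = ∑ j, ∑ w, prodPMF Q w * surprisal (Q j) (w.1 j, w.2 j) := Finset.sum_comm
    _ = ∑ j, ∑ u, Q j u * surprisal (Q j) u := by
        refine Finset.sum_congr rfl fun j _ => ?_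
        -- Weighting coordinate `j` alone makes the sum factor; every other factor is a total mass
        -- `1`.
        have h := sum_prod_pi_pair fun i u => Q i u * (if i = j then surprisal (Q j) u else 1)
        simp only [Finset.prod_mul_distrib, Finset.prod_ite_eq', Finset.mem_univ, if_true] at h
        calc _ = _ := h
          _ = _ := by
              rw [Finset.prod_eq_single j]
              · simp
              · intro i _ hij
                simp [hij, (hQ i).2]
              · simp

theorem mgf_surprisal_prodPMF_le (hQ : ∀ j, Q j ∈ stdSimplex ℝ (A × B)) {s b : ℝ}
    (hb : ∀ j, ∑ u, Q j u * Real.exp (s * surprisal (Q j) u)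
      ≤ Real.exp (s * meanSurprisal (Q j) + b)) :
    ∑ w, prodPMF Q w * Real.exp (s * surprisal (prodPMF Q) w)
      ≤ Real.exp (s * meanSurprisal (prodPMF Q) + n * b) := by
  calc ∑ w, prodPMF Q w * Real.exp (s * surprisal (prodPMF Q) w)
      = ∑ w : (Fin n → A) × (Fin n → B),
          ∏ j, (Q j (w.1 j, w.2 j) * Real.exp (s * surprisal (Q j) (w.1 j, w.2 j))) := by
        refine Finset.sum_congr rfl fun w _ => ?_
        rw [Finset.prod_mul_distrib]
        change prodPMF Q w * _ = prodPMF Q w * _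
        by_cases hw : prodPMF Q w = 0
        · simp [hw]
        · rw [surprisal_prodPMF (fun j => (hQ j).1) hw, Finset.mul_sum, Real.exp_sum]
    _ = ∏ j, ∑ u, Q j u * Real.exp (s * surprisal (Q j) u) :=
        sum_prod_pi_pair fun j u => Q j u * Real.exp (s * surprisal (Q j) u)
    _ ≤ ∏ j, Real.exp (s * meanSurprisal (Q j) + b) :=
        Finset.prod_le_prod (fun j _ => Finset.sum_nonneg fun u _ =>
          mul_nonneg ((hQ j).1 u) (Real.exp_pos _).le) fun j _ => hb j
    _ = _ := by
        rw [← Real.exp_sum, meanSurprisal_prodPMF hQ, Finset.sum_add_distrib, Finset.mul_sum]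
        simp

/-- The Chernoff bound for the surprisal of independent pairs. -/
theorem sum_prodPMF_le_exp (hQ : ∀ j, Q j ∈ stdSimplex ℝ (A × B)) {s a b : ℝ}
    (hb : ∀ j, ∑ u, Q j u * Real.exp (s * surprisal (Q j) u)
      ≤ Real.exp (s * meanSurprisal (Q j) + b))
    (f : (Fin n → A) × (Fin n → B) → ℝ) (hf : ∀ w, f w ≤ prodPMF Q w)
    (hE : ∀ w, 0 < prodPMF Q w → 0 < f w →
      s * meanSurprisal (prodPMF Q) + a ≤ s * surprisal (prodPMF Q) w) :
    ∑ w, f w ≤ Real.exp (n * b - a) := by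
  have hnn := prodPMF_nonneg fun j => (hQ j).1
  -- Exponential Markov inequality, pointwise. Since `s` may have either sign, it serves both tails.
  have h1 : ∑ w, f w ≤ ∑ w, Real.exp (-(s * meanSurprisal (prodPMF Q) + a))
      * (prodPMF Q w * Real.exp (s * surprisal (prodPMF Q) w)) := by
    refine Finset.sum_le_sum fun w _ => ?_
    rcases lt_or_ge 0 (f w) with hp | hp
    · have hw : 0 < prodPMF Q w := hp.trans_le (hf w)
      have h2 := hE w hw hp
      calc f w ≤ prodPMF Q w * 1 := by rw [mul_one]; exact hf w
        _ ≤ prodPMF Q w * Real.exp (-(s * meanSurprisal (prodPMF Q) + a)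
            + s * surprisal (prodPMF Q) w) := by
            gcongr
            exact Real.one_le_exp (by linarith)
        _ = _ := by rw [Real.exp_add]; ring
    · exact hp.trans (mul_nonneg (Real.exp_pos _).le
        (mul_nonneg (hnn w) (Real.exp_pos _).le))
  rw [← Finset.mul_sum] at h1
  refine h1.trans ((mul_le_mul_of_nonneg_left (mgf_surprisal_prodPMF_le hQ hb)
    (Real.exp_pos _).le).trans (le_of_eq ?_))
  rw [← Real.exp_add]
  congr 1
  ring

end Product

/-! ### The two tail bounds at distance of order `√n` from the entropy. -/

section Tails

variable {A B : Type*} [Fintype A] [Fintype B] {n : ℕ} {Q : Fin n → A × B → ℝ}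

theorem log_card_add_three_pos (A : Type*) [Fintype A] : 0 < Real.log (Fintype.card A + 3) :=
  Real.log_pos (by linarith [Nat.cast_nonneg (α := ℝ) (Fintype.card A)])

-- Chernoff with `s = c / (√n a)`, `a = log(|A| + 3)`, and deviation `√n c a`: the exponent is `n s²
-- a² / 2 - c² = -c²/2`, plus the cubic correction `48 |A| n s³`, of order `1/√n`.
open Classical in
theorem prodPMF_not_mem_guessList_le (hn : 0 < n) (hQ : ∀ j, Q j ∈ stdSimplex ℝ (A × B))
    {c : ℝ} (hc : 0 ≤ c) (hs : c / (√n * Real.log (Fintype.card A + 3)) ≤ 1 / 2) {lam : ℝ}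
    (hlam : meanSurprisal (prodPMF Q) + √n * c * Real.log (Fintype.card A + 3)
      ≤ lam * Real.log 2) :
    ∑ x, ∑ y, (if x ∈ guessList (prodPMF Q) lam y then 0 else prodPMF Q (x, y))
      ≤ Real.exp (-(c ^ 2 / 2)
        + 48 * Fintype.card A * (c / Real.log (Fintype.card A + 3)) ^ 3 / √n) := by
  have hA := log_card_add_three_pos A
  set a := Real.log (Fintype.card A + 3) with ha
  have hn' : (0 : ℝ) < n := by exact_mod_cast hn
  have hsn : 0 < √(n : ℝ) := Real.sqrt_pos.2 hn'
  have hnn := prodPMF_nonneg fun j => (hQ j).1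
  have hs0 : 0 ≤ c / (√n * a) := by positivity
  have hl2 : 0 < Real.log 2 := Real.log_pos one_lt_two
  have h := sum_prodPMF_le_exp hQ (fun j => mgf_surprisal_le (hQ j) hs0 hs)
    (a := c / (√n * a) * (√n * c * a))
    (fun w => if w.1 ∈ guessList (prodPMF Q) lam w.2 then 0 else prodPMF Q w)
    (fun w => by split_ifs; exacts [hnn w, le_rfl])
    (fun w hw hf => by
      rw [← mul_add]
      refine mul_le_mul_of_nonneg_left ?_ hs0
      have hnot : w.1 ∉ guessList (prodPMF Q) lam w.2 := fun hmem => by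
        simp [hmem] at hf
      have h1 : ¬ (-Real.logb 2 (condPMF (prodPMF Q) w.1 w.2) ≤ lam) := fun hle =>
        hnot ⟨condPMF_pos hnn hw, hle⟩
      rw [Real.logb, ← neg_div, div_le_iff₀ hl2] at h1
      unfold surprisal
      linarith)
  rw [Fintype.sum_prod_type] at h
  refine h.trans (le_of_eq ?_)
  rw [← ha]
  congr 1
  have e : (n : ℝ) = √n ^ 2 := (Real.sq_sqrt hn'.le).symm
  generalize √(n : ℝ) = m at *
  rw [e]
  field_simp
  ring

-- The lower tail with the same choice of `s`; the one-sided moment bound leaves no correction.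
open Classical in
theorem prodPMF_large_condPMF_le (hn : 0 < n) (hQ : ∀ j, Q j ∈ stdSimplex ℝ (A × B))
    {c : ℝ} (hc : 0 ≤ c) {κ : ℝ}
    (hκ : κ * Real.log 2
      ≤ meanSurprisal (prodPMF Q) - √n * c * Real.log (Fintype.card A + 3)) :
    ∑ x, ∑ y, (if (2 : ℝ) ^ (-κ) * ∑ x', prodPMF Q (x', y) < prodPMF Q (x, y)
      then prodPMF Q (x, y) else 0) ≤ Real.exp (-(c ^ 2 / 2)) := by
  have hA := log_card_add_three_pos A
  set a := Real.log (Fintype.card A + 3) with ha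
  have hn' : (0 : ℝ) < n := by exact_mod_cast hn
  have hsn : 0 < √(n : ℝ) := Real.sqrt_pos.2 hn'
  have hnn := prodPMF_nonneg fun j => (hQ j).1
  have hs0 : 0 ≤ c / (√n * a) := by positivity
  have h := sum_prodPMF_le_exp hQ (fun j => mgf_neg_surprisal_le (hQ j) hs0)
    (a := c / (√n * a) * (√n * c * a))
    (fun w => if (2 : ℝ) ^ (-κ) * ∑ x', prodPMF Q (x', w.2) < prodPMF Q w
      then prodPMF Q w else 0)
    (fun w => by split_ifs; exacts [le_rfl, hnn w])
    (fun w hw hf => by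
      have hlt : (2 : ℝ) ^ (-κ) * ∑ x', prodPMF Q (x', w.2) < prodPMF Q w := by
        by_contra hnot
        simp [hnot] at hf
      have hsum : 0 < ∑ x', prodPMF Q (x', w.2) := hw.trans_le
        (Finset.single_le_sum (f := fun x' => prodPMF Q (x', w.2)) (fun _ _ => hnn _)
          (Finset.mem_univ w.1))
      have h1 : (2 : ℝ) ^ (-κ) < condPMF (prodPMF Q) w.1 w.2 := by
        rw [condPMF, lt_div_iff₀ hsum]
        exact hlt
      have h2 := Real.log_lt_log (by positivity) h1
      rw [Real.log_rpow two_pos] at h2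
      have h3 : surprisal (prodPMF Q) w ≤ meanSurprisal (prodPMF Q) - √n * c * a := by
        unfold surprisal
        linarith
      have := mul_le_mul_of_nonneg_left h3 hs0
      linarith)
  rw [Fintype.sum_prod_type] at h
  refine h.trans (le_of_eq ?_)
  rw [← ha]
  congr 1
  have e : (n : ℝ) = √n ^ 2 := (Real.sq_sqrt hn'.le).symm
  generalize √(n : ℝ) = m at *
  rw [e]
  field_simp
  ring

end Tails

/-! ### Choice of parameters and the final bound. -/

section Main

theorem log_le_logb_two {x : ℝ} (hx : 1 ≤ x) : Real.log x ≤ Real.logb 2 x := by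
  have h2 : 0 < Real.log 2 := Real.log_pos one_lt_two
  rw [Real.logb, le_div_iff₀ h2]
  nlinarith [Real.log_nonneg hx, Real.log_two_lt_d9]

theorem secondOrderCoeff_nonneg (ε σ : ℝ) (k : ℕ) : 0 ≤ secondOrderCoeff ε σ k := by
  unfold secondOrderCoeff
  have : 0 ≤ Real.logb 2 ((k : ℝ) + 3) :=
    Real.logb_nonneg one_lt_two (by linarith [Nat.cast_nonneg (α := ℝ) k])
  positivity

variable {𝒳 𝒴 𝒵 : Type*} [Fintype 𝒳] [Fintype 𝒴] [Fintype 𝒵]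

theorem condEntropy_productSource_bound {n : ℕ} {P : Fin n → 𝒳 × 𝒴 × 𝒵 → ℝ}
    (hP : ∀ j, P j ∈ stdSimplex ℝ (𝒳 × 𝒴 × 𝒵)) :
    condEntropy (margSnd (productSource P)) - condEntropy (margFst (productSource P))
      ≤ n * Fintype.card 𝒳 / Real.log 2 := by
  have h2 : 0 < Real.log 2 := Real.log_pos one_lt_two
  rw [condEntropy_eq_meanSurprisal, condEntropy_eq_meanSurprisal, ← sub_div]
  gcongr
  have h0 := meanSurprisal_nonneg (margFst_mem (productSource_mem hP)).1
  have h1 : meanSurprisal (margSnd (productSource P)) ≤ n * Fintype.card 𝒳 := by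
    rw [margSnd_productSource, meanSurprisal_prodPMF fun j => margSnd_mem (hP j)]
    calc _ ≤ ∑ _j : Fin n, (Fintype.card 𝒳 : ℝ) :=
          Finset.sum_le_sum fun j _ => meanSurprisal_le (margSnd_mem (hP j))
      _ = _ := by simp
  linarith

/-- The protocol is secure and reliable for the list threshold `lam` and the hash length `t` once
the block length `n` is large; `γ` is the part of the error probability spent on hash
collisions. -/
theorem skaProtocol_isSecretKey {n : ℕ} (hn : 0 < n) {ε σ γ : ℝ} (hε0 : 0 < ε) (hε1 : ε < 1)
    (hσ0 : 0 < σ) (hσ1 : σ < 1) (hγ0 : 0 < γ) (hγ1 : γ ≤ 1) (hnγ : 1 ≤ n * γ)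
    (hs : √2 * √(Real.logb 2 (1 / ε)) / (√n * Real.log (Fintype.card 𝒳 + 3)) ≤ 1 / 2)
    (htail : Real.exp (-Real.logb 2 (1 / ε) + 48 * Fintype.card 𝒳
      * (√2 * √(Real.logb 2 (1 / ε)) / Real.log (Fintype.card 𝒳 + 3)) ^ 3 / √n) ≤ ε - γ)
    {P : Fin n → 𝒳 × 𝒴 × 𝒵 → ℝ} (hP : ∀ j, P j ∈ stdSimplex ℝ (𝒳 × 𝒴 × 𝒵)) {lam : ℝ}
    (hlam : lam = condEntropy (margFst (productSource P))
      + √n * (√2 * Real.logb 2 (Fintype.card 𝒳 + 3) * √(Real.logb 2 (1 / ε))))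
    {t : ℕ} (ht : t = ⌈lam + Real.logb 2 (1 / γ)⌉₊) {ℓ : ℕ}
    (hℓ : (ℓ : ℝ) ≤ condEntropy (margSnd (productSource P))
      - condEntropy (margFst (productSource P))
      - √(n : ℝ) * secondOrderCoeff ε σ (Fintype.card 𝒳)
      - Real.logb 2 (4 * (n : ℝ) ^ 3 / (ε * σ ^ 2)))
    {S S' : Type*} [Fintype S] [Nonempty S] [Fintype S'] [Nonempty S']
    {h : S → (Fin n → 𝒳) → Bits t} {h' : S' → (Fin n → 𝒳) → Bits ℓ}
    (hh : IsTwoUniversal h) (hh' : IsTwoUniversal h') :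
    (skaProtocol (margFst (productSource P)) lam h h').IsSecretKey (productSource P)
      (fun ω => h' ω.2.1.2 ω.1.1) ε σ := by
  classical
  have hp := productSource_mem hP
  have h2 : 0 < Real.log 2 := Real.log_pos one_lt_two
  have hn' : (1 : ℝ) ≤ n := by exact_mod_cast hn
  have hcard : ∀ m : ℕ, (Fintype.card (Bits m) : ℝ) = 2 ^ (m : ℝ) := fun m => by simp
  have hε : 0 ≤ Real.logb 2 (1 / ε) :=
    Real.logb_nonneg one_lt_two ((one_le_div hε0).2 hε1.le)
  have hσ2 : 1 ≤ 2 / σ := (one_le_div hσ0).2 (by linarith)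
  have hσ : 0 ≤ Real.logb 2 (2 / σ) := Real.logb_nonneg one_lt_two hσ2
  have hsq : ∀ u : ℝ, 0 ≤ u → (√2 * √u) ^ 2 / 2 = u := fun u hu => by
    rw [mul_pow, Real.sq_sqrt zero_le_two, Real.sq_sqrt hu]
    ring
  have hlogb : Real.logb 2 (Fintype.card 𝒳 + 3) * Real.log 2
      = Real.log (Fintype.card 𝒳 + 3) := by
    rw [Real.logb]
    field_simp
  have hγb : 0 ≤ Real.logb 2 (1 / γ) :=
    Real.logb_nonneg one_lt_two ((one_le_div hγ0).2 hγ1)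
  have hX3 : 0 ≤ Real.logb 2 ((Fintype.card 𝒳 : ℝ) + 3) :=
    Real.logb_nonneg one_lt_two (by linarith [Nat.cast_nonneg (α := ℝ) (Fintype.card 𝒳)])
  have hlam0 : 0 ≤ lam := by
    rw [hlam, condEntropy_eq_meanSurprisal]
    have := meanSurprisal_nonneg (margFst_mem hp).1
    positivity
  have ht1 : lam + Real.logb 2 (1 / γ) ≤ t := ht ▸ Nat.le_ceil _
  have ht2 : (t : ℝ) < lam + Real.logb 2 (1 / γ) + 1 :=
    ht ▸ Nat.ceil_lt_add_one (add_nonneg hlam0 hγb)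
  refine ⟨?_, ?_⟩
  · have hl : ∑ x, ∑ y, (if x ∈ guessList (margFst (productSource P)) lam y then 0
        else margFst (productSource P) (x, y)) ≤ ε - γ := by
      rw [condEntropy_eq_meanSurprisal] at hlam
      rw [margFst_productSource] at hlam ⊢
      refine (prodPMF_not_mem_guessList_le hn (fun j => margFst_mem (hP j))
        (c := √2 * √(Real.logb 2 (1 / ε))) (by positivity) hs ?_).trans ?_
      · rw [hlam, add_mul, div_mul_cancel₀ _ h2.ne', ← hlogb]
        apply le_of_eq
        ring
      · rwa [hsq _ hε]
    have hr := skaProtocol_reliability hp hh h' hl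
    have hcoll : (2 : ℝ) ^ lam / Fintype.card (Bits t) ≤ γ := by
      rw [hcard, div_le_iff₀ (by positivity)]
      calc (2 : ℝ) ^ lam = γ * 2 ^ (lam + Real.logb 2 (1 / γ)) := by
            rw [Real.rpow_add two_pos, Real.rpow_logb two_pos (by norm_num) (by positivity)]
            field_simp
        _ ≤ γ * 2 ^ (t : ℝ) := by
            gcongr
            exact one_le_two
    refine le_trans ?_ hr
    linarith
  · obtain ⟨κ, hκ⟩ : ∃ κ, κ = condEntropy (margSnd (productSource P))
      - √n * (√2 * Real.logb 2 (Fintype.card 𝒳 + 3) * √(Real.logb 2 (2 / σ))) := ⟨_, rfl⟩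
    have hbad : ∑ x, ∑ z, (if (2 : ℝ) ^ (-κ) * ∑ x', margSnd (productSource P) (x', z)
        < margSnd (productSource P) (x, z) then margSnd (productSource P) (x, z) else 0)
        ≤ σ / 2 := by
      have hκ' := hκ
      rw [condEntropy_eq_meanSurprisal] at hκ'
      rw [margSnd_productSource] at hκ' ⊢
      refine (prodPMF_large_condPMF_le hn (fun j => margSnd_mem (hP j))
        (c := √2 * √(Real.logb 2 (2 / σ))) (by positivity) ?_).trans ?_
      · rw [hκ', sub_mul, div_mul_cancel₀ _ h2.ne', ← hlogb]
        apply le_of_eq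
        ring
      · rw [hsq _ hσ]
        calc Real.exp (-Real.logb 2 (2 / σ)) ≤ Real.exp (-Real.log (2 / σ)) :=
              Real.exp_le_exp.2 (neg_le_neg (log_le_logb_two hσ2))
          _ = σ / 2 := by
              rw [Real.exp_neg, Real.exp_log (by positivity), inv_div]
    refine (skaProtocol_security hp (margFst (productSource P)) lam (by positivity) h hh'
      hbad).trans ?_
    -- The logarithmic term of `L` equals `2 + 3 log n + log(1/ε) - 2 log σ`. It absorbs the `1`
    -- from rounding `t` up and `log(1/γ) ≤ log n`, and leaves the `2 log σ` that the square root
    -- needs.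
    have hexp : (t : ℝ) + ℓ + -κ ≤ 2 * Real.logb 2 σ := by
      have e1 : Real.logb 2 (4 * (n : ℝ) ^ 3 / (ε * σ ^ 2))
          = 2 + 3 * Real.logb 2 n + Real.logb 2 (1 / ε) - 2 * Real.logb 2 σ := by
        have e4 : Real.logb 2 (4 : ℝ) = 2 := by
          rw [show (4 : ℝ) = 2 ^ (2 : ℝ) by norm_num, Real.logb_rpow two_pos (by norm_num)]
        rw [Real.logb_div (by positivity) (by positivity), Real.logb_mul (by positivity)
          (by positivity), Real.logb_mul (by positivity) (by positivity), Real.logb_pow,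
          Real.logb_pow, e4, one_div, Real.logb_inv]
        push_cast
        ring
      have e2 : Real.logb 2 (1 / γ) ≤ Real.logb 2 n := by
        refine Real.logb_le_logb_of_le one_lt_two (by positivity) ?_
        rwa [div_le_iff₀ hγ0]
      have e3 : 0 ≤ Real.logb 2 n := Real.logb_nonneg one_lt_two hn'
      rw [e1, secondOrderCoeff] at hℓ
      rw [hκ]
      rw [hlam] at ht2
      nlinarith
    have hsqrt : √(Fintype.card (Bits t) * Fintype.card (Bits ℓ) * (2 : ℝ) ^ (-κ)) ≤ σ := by
      rw [Real.sqrt_le_left hσ0.le, hcard, hcard, ← Real.rpow_add two_pos,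
        ← Real.rpow_add two_pos]
      calc (2 : ℝ) ^ ((t : ℝ) + ℓ + -κ) ≤ 2 ^ (2 * Real.logb 2 σ) :=
            Real.rpow_le_rpow_of_exponent_le one_le_two hexp
        _ = σ ^ 2 := by
            rw [mul_comm, Real.rpow_mul two_pos.le, Real.rpow_logb two_pos (by norm_num) hσ0]
            norm_num
    linarith

/-- For every large block length, the tail bound leaves a fixed part `γ` of the error probability
for hash collisions. -/
theorem exists_collision_budget {ε : ℝ} (hε0 : 0 < ε) (hε1 : ε < 1) (k : ℕ) :
    ∃ γ : ℝ, 0 < γ ∧ γ ≤ 1 ∧ ∀ᶠ n : ℕ in Filter.atTop, 1 ≤ n * γ ∧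
      √2 * √(Real.logb 2 (1 / ε)) / (√n * Real.log (k + 3)) ≤ 1 / 2 ∧
      Real.exp (-Real.logb 2 (1 / ε) + 48 * k
        * (√2 * √(Real.logb 2 (1 / ε)) / Real.log (k + 3)) ^ 3 / √n) ≤ ε - γ := by
  have hlog : 0 < Real.log (1 / ε) := Real.log_pos ((one_lt_div hε0).2 hε1)
  -- Strict because `log 2 < 1`: the base-2 logarithm exceeds the natural one.
  have hlt : Real.exp (-Real.logb 2 (1 / ε)) < ε := by
    rw [← Real.lt_log_iff_exp_lt hε0, neg_lt, ← Real.log_inv, ← one_div, Real.logb,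
      lt_div_iff₀ (Real.log_pos one_lt_two)]
    nlinarith [Real.log_two_lt_d9]
  have hexp := Real.exp_pos (-Real.logb 2 (1 / ε))
  -- `γ` is half of the gap; the other half absorbs the `1/√n` correction once `n` is large.
  refine ⟨(ε - Real.exp (-Real.logb 2 (1 / ε))) / 2, by linarith, by linarith, ?_⟩
  have hsq : Filter.Tendsto (fun n : ℕ => √(n : ℝ)) Filter.atTop Filter.atTop :=
    Real.tendsto_sqrt_atTop.comp tendsto_natCast_atTop_atTop
  refine Filter.Eventually.and ?_ (Filter.Eventually.and ?_ ?_)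
  · exact (tendsto_natCast_atTop_atTop.atTop_mul_const (by linarith)).eventually_ge_atTop 1
  · have h := (hsq.const_div_atTop
      (√2 * √(Real.logb 2 (1 / ε)) / Real.log (k + 3))).eventually_le_const
      (by norm_num : (0 : ℝ) < 1 / 2)
    filter_upwards [h] with n hn
    rwa [div_div, mul_comm (Real.log _)] at hn
  · have h := hsq.const_div_atTop
      (48 * k * (√2 * √(Real.logb 2 (1 / ε)) / Real.log (k + 3)) ^ 3)
    have h' := (Real.continuous_exp.tendsto _).comp
      (h.const_add (-Real.logb 2 (1 / ε)))
    refine h'.eventually_le_const ?_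
    rw [add_zero]
    linarith

end Main

theorem theorem1 {𝒳 : Type*} [Fintype 𝒳] (ε σ : ℝ) (hε0 : 0 < ε) (hε1 : ε < 1)
    (hσ0 : 0 < σ) (hσ1 : σ < 1) :
    ∃ C : ℝ, ∀ n : ℕ, 1 ≤ n →
      ∀ (𝒴 𝒵 : Type*) [Fintype 𝒴] [Fintype 𝒵] (P : Fin n → 𝒳 × 𝒴 × 𝒵 → ℝ),
      (∀ j, P j ∈ stdSimplex ℝ (𝒳 × 𝒴 × 𝒵)) →
      -- the key length `L`, the list threshold `lam` and the length `t` of the sent hash value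
      ∃ (L lam : ℝ) (t : ℕ),
        |L - (condEntropy (margSnd (productSource P)) - condEntropy (margFst (productSource P))
            - √(n : ℝ) * secondOrderCoeff ε σ (Fintype.card 𝒳)
            - Real.logb 2 (4 * (n : ℝ) ^ 3 / (ε * σ ^ 2)))| ≤ C / √(n : ℝ) ∧
        ∀ ℓ : ℕ, (ℓ : ℝ) ≤ L →
          ∀ (S S' : Type*) [Fintype S] [Nonempty S] [Fintype S'] [Nonempty S']
            (h : S → (Fin n → 𝒳) → Bits t) (h' : S' → (Fin n → 𝒳) → Bits ℓ),
            IsTwoUniversal h → IsTwoUniversal h' →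
            (skaProtocol (margFst (productSource P)) lam h h').IsSecretKey (productSource P)
              (fun ω => h' ω.2.1.2 ω.1.1) ε σ := by
  obtain ⟨γ, hγ0, hγ1, hev⟩ := exists_collision_budget hε0 hε1 (Fintype.card 𝒳)
  obtain ⟨N, hN⟩ := Filter.eventually_atTop.1 hev
  have h2 : 0 < Real.log 2 := Real.log_pos one_lt_two
  -- For `n < N` this makes `C/√n` exceed the crude bound `n |𝒳| / log 2` on the entropy difference
  -- by at least `1`. `N` depends only on `ε` and `|𝒳|`.
  obtain ⟨C, hC⟩ : ∃ C : ℝ, C = (N + 1) * ((N + 1) * Fintype.card 𝒳 / Real.log 2 + 1) := ⟨_, rfl⟩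
  have hC0 : 0 ≤ C := by rw [hC]; positivity
  refine ⟨C, fun n hn 𝒴 𝒵 _ _ P hP => ?_⟩
  have hn' : (1 : ℝ) ≤ n := by exact_mod_cast hn
  rcases le_or_gt N n with hNn | hNn
  · obtain ⟨h1, h3, h4⟩ := hN n hNn
    refine ⟨condEntropy (margSnd (productSource P)) - condEntropy (margFst (productSource P))
            - √(n : ℝ) * secondOrderCoeff ε σ (Fintype.card 𝒳)
            - Real.logb 2 (4 * (n : ℝ) ^ 3 / (ε * σ ^ 2)), _, _, ?_,
      fun ℓ hℓ S S' _ _ _ _ h h' hh hh' =>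
        skaProtocol_isSecretKey hn hε0 hε1 hσ0 hσ1 hγ0 hγ1 h1 h3 h4 hP rfl rfl hℓ hh hh'⟩
    rw [sub_self, abs_zero]
    positivity
  -- Small `n`: with `r = -C/√n` the number `L` is negative, so `lam` and `t` are arbitrary.
  · refine ⟨condEntropy (margSnd (productSource P)) - condEntropy (margFst (productSource P))
            - √(n : ℝ) * secondOrderCoeff ε σ (Fintype.card 𝒳)
            - Real.logb 2 (4 * (n : ℝ) ^ 3 / (ε * σ ^ 2)) - C / √n, 0, 0, ?_, fun ℓ hℓ => ?_⟩
    · rw [sub_sub_cancel_left, abs_neg, abs_of_nonneg (by positivity)]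
    · exfalso
      have hent := condEntropy_productSource_bound hP
      have hcoef := mul_nonneg (Real.sqrt_nonneg n) (secondOrderCoeff_nonneg ε σ (Fintype.card 𝒳))
      have hlog : 0 ≤ Real.logb 2 (4 * (n : ℝ) ^ 3 / (ε * σ ^ 2)) := by
        refine Real.logb_nonneg one_lt_two ?_
        rw [one_le_div (by positivity)]
        have e1 : σ ^ 2 ≤ 1 := pow_le_one₀ hσ0.le hσ1.le
        have e2 : ε * σ ^ 2 ≤ 1 := mul_le_one₀ hε1.le (by positivity) e1
        have e3 : (1 : ℝ) ≤ (n : ℝ) ^ 3 := one_le_pow₀ hn'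
        linarith
      have hnN : (n : ℝ) ≤ N + 1 := by exact_mod_cast hNn.le.trans (Nat.le_succ N)
      have hdiv : (N + 1) * Fintype.card 𝒳 / Real.log 2 + 1 ≤ C / √n := by
        rw [le_div_iff₀ (Real.sqrt_pos.2 (by linarith)), hC, mul_comm]
        gcongr
        rw [Real.sqrt_le_left (by positivity)]
        nlinarith
      have hent' : n * Fintype.card 𝒳 / Real.log 2 ≤ (N + 1) * Fintype.card 𝒳 / Real.log 2 := by
        gcongr
      linarith [Nat.cast_nonneg (α := ℝ) ℓ]
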